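/- **Setting.** Let $m=2^n$. A distribution oracle is an arbitrary unitary $O_D$ on $n+a$ qubits; write $O_D|0^{n+a}\rangle=\sum_{x\in\{0,1\}^n}\alpha_x|x\rangle|\psi_x\rangle$ with unit vectors $|\psi_x\rangle$, so that $p_x=|\alpha_x|^2$ is the probability of observing $x$ when the first $n$ qubits are measured in the standard basis, and put $p_{\max}=\max_x p_x$. A quantum algorithm for given $n,a$ is a finite, classically controlled sequence of quantum circuits: each circuit starts in the all-zero state, alternates oracle-independent unitaries with queries, each query being one application of $O_D$ or $O_D^{\dagger}$, and is measured in the standard basis at its end; the observed outcomes determine which circuit is run next, or the real number that is output. The number of queries of a run is the total over its circuits; the number of qubits of an algorithm is the largest size of a circuit that it can run. Algorithms may depend on $n,a,\epsilon,\delta$, but not on the oracle (in particular not on $p_{\max}$). **Lemma (approximating $p_{\max}$).** All implied constants below are absolute, i.e. independent of $n,a,\epsilon,\delta$ and of the oracle. 1. (Additive accuracy.) For all $n,a\ge 0$, $\epsilon\in(0,1)$ and $\delta\in(0,\tfrac12]$ there is a quantum algorithm that, for every distribution oracle $O_D$ on $n+a$ qubits, uses $O\big((\log m+\log\tfrac1\epsilon+a)\log\tfrac1{\delta\,p_{\max}}\big)$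 qubits and, with probability at least $1-\delta$, makes $O\big(\tfrac{1}{\epsilon\sqrt{p_{\max}}}\log(\tfrac1\epsilon)\log(\tfrac1{\delta\,p_{\max}})\big)$ queries and outputs an estimate $\widehat{p}$ with $|p_{\max}-\widehat p|\le\epsilon$. 2. (Relative accuracy.) There is an absolute constant $c$ such that for all $n,a\ge 0$, $\epsilon\in(0,1)$ and $\delta\in(0,\tfrac12]$ there is a quantum algorithm that always makes $\tilde O(m^{3/2}/\epsilon)$ queries, namely $O\big(\tfrac{m^{3/2}}{\epsilon}\,(1+\log\tfrac m\epsilon)^{c}\log\tfrac1\delta\big)$, and that, for every distribution oracle $O_D$ on $n+a$ qubits, uses $O\big((\log\tfrac m\epsilon+a)\log\tfrac1{\delta\,p_{\max}}\big)$ qubits and outputs, with probability at least $1-\delta$, an estimate $\widehat p$ with $(1-\epsilon)\,\widehat p\le p_{\max}\le\widehat p$ (hence also $(1-\epsilon)^2\,\widehat p\le p_{\max}\le\widehat p$). -/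

import Mathlib

open scoped Kronecker

namespace PMax

/-- Labels of the computational (standard) basis of `k` qubits. -/
abbrev Bits (k : ℕ) : Type := Fin k → Bool

/-- The label of the basis state `|0^k⟩`. -/
def zeros (k : ℕ) : Bits k := fun _ => false

/-- A distribution oracle on `n + a` qubits: an arbitrary unitary `O_D`. The first register
(`n = log₂ m` qubits) carries the domain of size `m = 2 ^ n`, the second one the `a` ancillas. -/
abbrev Oracle (n a : ℕ) : Type := Matrix.unitaryGroup (Bits n × Bits a) ℂ

/-- `p_x`: the probability of observing `x` when the first `n` qubits of `O_D |0^(n+a)⟩` are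
measured in the standard basis. -/
noncomputable def outputProb {n a : ℕ} (U : Oracle n a) (x : Bits n) : ℝ :=
  ∑ y : Bits a, ‖U.1 (x, y) (zeros n, zeros a)‖ ^ 2

/-- `p_max = max_x p_x`. -/
noncomputable def pMax {n a : ℕ} (U : Oracle n a) : ℝ := ⨆ x : Bits n, outputProb U x

/-- Standard basis labels of a workspace with `b` qubits besides those on which the oracle acts. -/
abbrev Work (n a b : ℕ) : Type := (Bits n × Bits a) × Bits b

/-- A quantum query circuit on `n + a + extra` qubits: the gate `init`, followed by steps, each of
which is one query (to `O_D` for `false`, to `O_D⁻¹ = O_D†` for `true`) followed by a gate. The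
gates are arbitrary unitaries on the workspace that do not depend on the oracle. -/
structure Circuit (n a : ℕ) where
  extra : ℕ
  init : Matrix.unitaryGroup (Work n a extra) ℂ
  steps : List (Bool × Matrix.unitaryGroup (Work n a extra) ℂ)

namespace Circuit

variable {n a : ℕ}

/-- The number of queries made by the circuit. -/
def queries (c : Circuit n a) : ℕ := c.steps.length

/-- The number of qubits of the circuit. -/
def qubits (c : Circuit n a) : ℕ := n + a + c.extra

/-- The results of measuring all qubits of the circuit in the standard basis. -/
abbrev Outcome (c : Circuit n a) : Type := Work n a c.extra

end Circuit

/-- The action of one query on the workspace: `O_D ⊗ 1` or `O_D† ⊗ 1`. -/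
noncomputable def queryOp {n a : ℕ} (U : Oracle n a) (b : ℕ) (inverse : Bool) :
    Matrix (Work n a b) (Work n a b) ℂ :=
  (if inverse then U.1.conjTranspose else U.1) ⊗ₖ (1 : Matrix (Bits b) (Bits b) ℂ)

/-- The final state of the circuit with oracle `U`, started in the all-zero basis state. -/
noncomputable def Circuit.finalState {n a : ℕ} (c : Circuit n a) (U : Oracle n a) :
    Work n a c.extra → ℂ :=
  c.steps.foldl (fun ψ s => s.2.1.mulVec ((queryOp U c.extra s.1).mulVec ψ))
    (c.init.1.mulVec (Pi.single ((zeros n, zeros a), zeros c.extra) 1))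

/-- Born's rule: the probability of the measurement outcome `z`. -/
noncomputable def Circuit.outcomeProb {n a : ℕ} (c : Circuit n a) (U : Oracle n a)
    (z : c.Outcome) : ℝ :=
  ‖c.finalState U z‖ ^ 2

/-- A quantum algorithm with classical control that outputs a real number: it either stops with
its output, or runs a circuit from the all-zero state, measures it in the standard basis, and
continues depending on what was observed. The oracle is accessed only through the queries of the
circuits. -/
inductive Algorithm (n a : ℕ) : Type
  | output (estimate : ℝ) : Algorithm n a
  | run (c : Circuit n a) (next : c.Outcome → Algorithm n a) : Algorithm n a

namespace Algorithm

variable {n a : ℕ}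

/-- The worst-case number of qubits: the largest circuit on any branch (the qubits are reused from
one circuit to the next). -/
def qubits : Algorithm n a → ℕ
  | output _ => 0
  | run c next => max c.qubits (Finset.univ.sup fun z => (next z).qubits)

/-- The worst-case number of queries: the largest total number of queries on any branch. -/
def maxQueries : Algorithm n a → ℕ
  | output _ => 0
  | run c next => c.queries + Finset.univ.sup fun z => (next z).maxQueries

open scoped Classical in
/-- `prob U alg E` is the probability that a run of `alg` with oracle `U` ends with an estimate `v`
after a total number `q` of queries such that `E v q` holds. -/
noncomputable def prob (U : Oracle n a) : Algorithm n a → (ℝ → ℕ → Prop) → ℝ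
  | output v, E => if E v 0 then 1 else 0
  | run c next, E =>
      ∑ z, c.outcomeProb U z * prob U (next z) fun v q => E v (c.queries + q)

end Algorithm

end PMax

namespace PMax

/-! ### Born's rule defines a probability distribution -/

/-! Write `s = √p_max`. For a fixed outcome `x`, the Grover iteration rotates a plane by twice the
angle `θ` with `sin θ = √p_x`, so phase estimation with `2 ^ k` iterations finds `√p_x` up to `O(2 ^
(-k))`. The counter register carries a triangular window instead of the uniform superposition: the
differences of the window are small in `ℓ²`, so Parseval bounds the second moment of the phase error
by `O(4 ^ (-k))`, and Chebyshev's inequality gives a constant success probability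
(`exists_amplitudeTrial`). A majority among `2 * T + 1` runs makes the error probability
exponentially small in `T` (`exists_amplitudeEstimate`).

Relative accuracy (`exists_relativeEstimate`): since `s ≥ 1 / √m`, it suffices to estimate all `m`
amplitudes with precision of order `ε / √m`; this costs `m * (√m / ε)` queries up to logarithms.

Additive accuracy (`exists_search`): as `|s² - r²| = |s - r| (s + r)`, precision of order `ε / s`
for `s` is enough, at about `s / ε` queries per outcome. About `1 / s²` samples, up to logarithms,
leave `O(1 / s²)` candidates that include a most likely outcome (`exists_candidates`), for a total
of about `1 / (ε * s)`. The size of `s` is unknown, so stage `i` works under the guess `s ≈ 2 ^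
(-i)` and accepts if its estimate is of that order. Stage costs grow like `2 ^ i`, so the last stage
dominates; the stage failures `δ / 2 ^ (i + 1)` sum to at most `δ`. Once `4 ^ (-i)` is below the
order of `ε`, the answer `0` is accurate enough. -/

theorem sum_norm_sq_mulVec {ι : Type*} [Fintype ι] [DecidableEq ι] {A : Matrix ι ι ℂ}
    (hA : A ∈ Matrix.unitaryGroup ι ℂ) (v : ι → ℂ) :
    ∑ i, ‖(A.mulVec v) i‖ ^ 2 = ∑ i, ‖v i‖ ^ 2 := by
  have key : ∀ u : ι → ℂ, ((∑ i, ‖u i‖ ^ 2 : ℝ) : ℂ) = star u ⬝ᵥ u := by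
    intro u
    simp [dotProduct, Complex.conj_mul']
  have h : star (A.mulVec v) ⬝ᵥ A.mulVec v = star v ⬝ᵥ v := by
    rw [Matrix.star_mulVec, Matrix.dotProduct_mulVec, Matrix.vecMul_vecMul,
      ← Matrix.star_eq_conjTranspose, Matrix.mem_unitaryGroup_iff'.1 hA, Matrix.vecMul_one]
  rw [← key, ← key] at h
  exact_mod_cast h

theorem queryOp_mem_unitaryGroup {n a : ℕ} (U : Oracle n a) (b : ℕ) (inverse : Bool) :
    queryOp U b inverse ∈ Matrix.unitaryGroup (Work n a b) ℂ := by
  unfold queryOp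
  refine Matrix.kronecker_mem_unitary ?_ (one_mem _)
  split_ifs
  · exact Unitary.star_mem U.2
  · exact U.2

theorem Circuit.sum_outcomeProb {n a : ℕ} (c : Circuit n a) (U : Oracle n a) :
    ∑ z, c.outcomeProb U z = 1 := by
  have fold : ∀ (l : List (Bool × Matrix.unitaryGroup (Work n a c.extra) ℂ))
      (ψ : Work n a c.extra → ℂ),
      ∑ z, ‖(l.foldl (fun ψ s => s.2.1.mulVec ((queryOp U c.extra s.1).mulVec ψ)) ψ) z‖ ^ 2 =
        ∑ z, ‖ψ z‖ ^ 2 := by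
    intro l
    induction l with
    | nil => intro ψ; rfl
    | cons s l ih =>
      intro ψ
      rw [List.foldl_cons, ih, sum_norm_sq_mulVec s.2.2,
        sum_norm_sq_mulVec (queryOp_mem_unitaryGroup U _ _)]
  unfold Circuit.outcomeProb Circuit.finalState
  rw [fold, sum_norm_sq_mulVec c.init.2]
  simp [Pi.single_apply, apply_ite]

theorem Circuit.outcomeProb_nonneg {n a : ℕ} (c : Circuit n a) (U : Oracle n a) (z : c.Outcome) :
    0 ≤ c.outcomeProb U z := sq_nonneg _

/-! ### Output probabilities -/

theorem outputProb_nonneg {n a : ℕ} (U : Oracle n a) (x : Bits n) : 0 ≤ outputProb U x :=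
  Finset.sum_nonneg fun _ _ => sq_nonneg _

theorem sum_outputProb {n a : ℕ} (U : Oracle n a) : ∑ x, outputProb U x = 1 := by
  have h := sum_norm_sq_mulVec U.2 (Pi.single (zeros n, zeros a) 1)
  simp only [Matrix.mulVec_single_one, Matrix.col_apply] at h
  rw [Fintype.sum_prod_type] at h
  unfold outputProb
  rw [h]
  simp [Pi.single_apply, apply_ite]

theorem outputProb_le_one {n a : ℕ} (U : Oracle n a) (x : Bits n) : outputProb U x ≤ 1 := by
  rw [← sum_outputProb U]
  exact Finset.single_le_sum (f := outputProb U) (fun _ _ => outputProb_nonneg U _)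
    (Finset.mem_univ x)

theorem outputProb_le_pMax {n a : ℕ} (U : Oracle n a) (x : Bits n) : outputProb U x ≤ pMax U :=
  le_ciSup (f := outputProb U) (Set.finite_range _).bddAbove x

theorem exists_outputProb_eq_pMax {n a : ℕ} (U : Oracle n a) : ∃ x, outputProb U x = pMax U :=
  exists_eq_ciSup_of_finite

theorem pMax_le_one {n a : ℕ} (U : Oracle n a) : pMax U ≤ 1 := ciSup_le (outputProb_le_one U)

theorem one_le_two_pow_mul_pMax {n a : ℕ} (U : Oracle n a) : 1 ≤ 2 ^ n * pMax U := by
  have h := Finset.sum_le_card_nsmul Finset.univ (outputProb U) (pMax U)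
    fun x _ => outputProb_le_pMax U x
  rw [sum_outputProb] at h
  simpa using h

theorem pMax_pos {n a : ℕ} (U : Oracle n a) : 0 < pMax U := by
  have := one_le_two_pow_mul_pMax U
  by_contra! h
  nlinarith [show (0 : ℝ) < 2 ^ n by positivity]

/-! ### Programs: algorithms with outputs of an arbitrary type -/

/-- Quantum algorithms with classical control and outputs in `α`. -/
inductive Prog (n a : ℕ) (α : Type) : Type
  | pure (v : α) : Prog n a α
  | run (c : Circuit n a) (next : c.Outcome → Prog n a α) : Prog n a α

namespace Prog

variable {n a : ℕ} {α β : Type}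

/-- A program with real outputs is an algorithm. -/
def toAlgorithm : Prog n a ℝ → Algorithm n a
  | pure v => .output v
  | run c next => .run c fun z => (next z).toAlgorithm

/-- Sequential composition. -/
def bind : Prog n a α → (α → Prog n a β) → Prog n a β
  | pure v, f => f v
  | run c next, f => run c fun z => (next z).bind f

/-- `p.Bounded k q`: the circuits of `p` have at most `k` qubits, and every branch makes at most
`q` queries. -/
def Bounded : Prog n a α → ℕ → ℕ → Prop
  | pure _, _, _ => True
  | run c next, k, q => c.qubits ≤ k ∧ c.queries ≤ q ∧ ∀ z, (next z).Bounded k (q - c.queries)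

open scoped Classical in
/-- The probability that a run of the program violates `P v q`, where `v` is the output and `q` the
number of queries. -/
noncomputable def failure (U : Oracle n a) : Prog n a α → (α → ℕ → Prop) → ℝ
  | pure v, P => if P v 0 then 0 else 1
  | run c next, P => ∑ z, c.outcomeProb U z * failure U (next z) fun v q => P v (c.queries + q)

theorem Bounded.mono {p : Prog n a α} {k k' q q' : ℕ} (h : p.Bounded k q) (hk : k ≤ k')
    (hq : q ≤ q') : p.Bounded k' q' := by
  induction p generalizing q q' with
  | pure v => trivial
  | run c next ih =>
    exact ⟨h.1.trans hk, h.2.1.trans hq, fun z => ih z (h.2.2 z) (by omega)⟩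

theorem Bounded.bind {p : Prog n a α} {f : α → Prog n a β} {k q r : ℕ} (hp : p.Bounded k q)
    (hf : ∀ v, (f v).Bounded k r) : (p.bind f).Bounded k (q + r) := by
  induction p generalizing q with
  | pure v => exact (hf v).mono le_rfl (by omega)
  | run c next ih =>
    obtain ⟨h1, h2, h3⟩ := hp
    exact ⟨h1, by omega, fun z => (ih z (h3 z)).mono le_rfl (by omega)⟩

theorem Bounded.bind_pure {p : Prog n a α} {k q : ℕ} (hp : p.Bounded k q) (f : α → β) :
    (p.bind fun v => pure (f v)).Bounded k q :=
  Bounded.bind (r := 0) hp fun _ => trivial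

theorem Bounded.qubits_le {p : Prog n a ℝ} {k q : ℕ} (h : p.Bounded k q) :
    p.toAlgorithm.qubits ≤ k := by
  induction p generalizing q with
  | pure v => exact Nat.zero_le _
  | run c next ih =>
    exact max_le h.1 (Finset.sup_le fun z _ => ih z (h.2.2 z))

theorem Bounded.maxQueries_le {p : Prog n a ℝ} {k q : ℕ} (h : p.Bounded k q) :
    p.toAlgorithm.maxQueries ≤ q := by
  induction p generalizing q with
  | pure v => exact Nat.zero_le _
  | run c next ih =>
    have : (Finset.univ.sup fun z => (next z).toAlgorithm.maxQueries) ≤ q - c.queries :=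
      Finset.sup_le fun z _ => ih z (h.2.2 z)
    have h2 := h.2.1
    exact (Nat.add_le_add_left this _).trans (by omega)

theorem prob_toAlgorithm (U : Oracle n a) (p : Prog n a ℝ) (P : ℝ → ℕ → Prop) :
    p.toAlgorithm.prob U P = 1 - p.failure U P := by
  classical
  induction p generalizing P with
  | pure v =>
    simp only [toAlgorithm, Algorithm.prob, failure]
    split_ifs <;> simp
  | run c next ih =>
    simp only [toAlgorithm, Algorithm.prob, failure, ih, mul_sub, mul_one, Finset.sum_sub_distrib,
      c.sum_outcomeProb]

theorem failure_nonneg (U : Oracle n a) (p : Prog n a α) (P : α → ℕ → Prop) :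
    0 ≤ p.failure U P := by
  induction p generalizing P with
  | pure v => simp only [failure]; split_ifs <;> simp
  | run c next ih =>
    exact Finset.sum_nonneg fun z _ => mul_nonneg (c.outcomeProb_nonneg U z) (ih _ _)

theorem failure_le_one (U : Oracle n a) (p : Prog n a α) (P : α → ℕ → Prop) :
    p.failure U P ≤ 1 := by
  induction p generalizing P with
  | pure v => simp only [failure]; split_ifs <;> simp
  | run c next ih =>
    rw [← c.sum_outcomeProb U]
    exact Finset.sum_le_sum fun z _ => mul_le_of_le_one_right (c.outcomeProb_nonneg U z) (ih _ _)

theorem failure_mono (U : Oracle n a) (p : Prog n a α) {P Q : α → ℕ → Prop}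
    (h : ∀ v q, P v q → Q v q) : p.failure U Q ≤ p.failure U P := by
  induction p generalizing P Q with
  | pure v =>
    by_cases hP : P v 0
    · simp [failure, hP, h _ _ hP]
    · simp only [failure, hP, if_false]; split_ifs <;> simp
  | run c next ih =>
    exact Finset.sum_le_sum fun z _ => mul_le_mul_of_nonneg_left
      (ih z fun v q => h v _) (c.outcomeProb_nonneg U z)

theorem failure_pure (U : Oracle n a) {v : α} {P : α → ℕ → Prop} (h : P v 0) :
    (pure v : Prog n a α).failure U P = 0 := by
  simp [failure, h]

theorem failure_eq_zero (U : Oracle n a) (p : Prog n a α) {P : α → ℕ → Prop} (h : ∀ v q, P v q) :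
    p.failure U P = 0 := by
  induction p generalizing P with
  | pure v => exact failure_pure U (h _ _)
  | run c next ih => simp [failure, ih _ fun v q => h v (c.queries + q)]

/-- If the second of two programs fails with probability at most `b` after an output of the first
one that is in `P`, and with probability at most `b'` otherwise, then this bounds the failure
probability of the composition. -/
theorem failure_bind_le_of_le (U : Oracle n a) (p : Prog n a α) (f : α → Prog n a β)
    {P : α → ℕ → Prop} {Q : β → ℕ → Prop} {b b' : ℝ}
    (h : ∀ v q, P v q → (f v).failure U (fun w r => Q w (q + r)) ≤ b)
    (h' : ∀ v q, (f v).failure U (fun w r => Q w (q + r)) ≤ b') :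
    (p.bind f).failure U Q ≤ b + p.failure U P * (b' - b) := by
  induction p generalizing P Q with
  | pure v =>
    by_cases hP : P v 0
    · simpa [failure, hP, bind] using h v 0 hP
    · simpa [failure, hP, bind] using h' v 0
  | run c next ih =>
    calc ((run c next).bind f).failure U Q
        = ∑ z, c.outcomeProb U z *
            ((next z).bind f).failure U fun v q => Q v (c.queries + q) := rfl
      _ ≤ ∑ z, c.outcomeProb U z *
            (b + (next z).failure U (fun v q => P v (c.queries + q)) * (b' - b)) := by
          refine Finset.sum_le_sum fun z _ => mul_le_mul_of_nonneg_left
            (ih z (fun v q hv => ?_) fun v q => ?_) (c.outcomeProb_nonneg U z)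
          · simpa only [add_assoc] using h v _ hv
          · simpa only [add_assoc] using h' v (c.queries + q)
      _ = b + (run c next).failure U P * (b' - b) := by
          simp only [failure, mul_add, Finset.sum_add_distrib, ← Finset.sum_mul,
            c.sum_outcomeProb, one_mul, ← mul_assoc]

/-- The union bound, with the cost of the first program carried over into the event for the second.
-/
theorem failure_bind_le (U : Oracle n a) (p : Prog n a α) (f : α → Prog n a β)
    {P : α → ℕ → Prop} {Q : β → ℕ → Prop} {b b' : ℝ} (hp : p.failure U P ≤ b) (hb : 0 ≤ b')
    (h : ∀ v q, P v q → (f v).failure U (fun w r => Q w (q + r)) ≤ b') :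
    (p.bind f).failure U Q ≤ b + b' := by
  have := failure_bind_le_of_le U p f h fun v q => failure_le_one U _ _
  nlinarith [failure_nonneg U p P]

/-- A worst-case query bound holds on every branch, so it can be added to any event for free. The
search uses this to charge each stage only when it is reached. -/
theorem Bounded.failure_and_le (U : Oracle n a) {p : Prog n a α} {k q : ℕ} (h : p.Bounded k q)
    (P : α → ℕ → Prop) : p.failure U (fun v r => P v r ∧ r ≤ q) ≤ p.failure U P := by
  induction p generalizing P q with
  | pure v => by_cases hP : P v 0 <;> simp [failure, hP]
  | run c next ih =>
    refine Finset.sum_le_sum fun z _ => mul_le_mul_of_nonneg_left ?_ (c.outcomeProb_nonneg U z)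
    refine le_trans (failure_mono U _ ?_) (ih z (h.2.2 z) _)
    have := h.2.1
    exact fun v r hr => ⟨hr.1, by omega⟩

/-- `N` independent runs of a program. -/
def replicate (p : Prog n a α) : (N : ℕ) → Prog n a (Fin N → α)
  | 0 => pure Fin.elim0
  | N + 1 => p.bind fun v => (p.replicate N).bind fun w => pure (Fin.cons v w)

theorem Bounded.replicate {p : Prog n a α} {k q : ℕ} (h : p.Bounded k q) (N : ℕ) :
    (p.replicate N).Bounded k (N * q) := by
  induction N with
  | zero => trivial
  | succ N ih =>
    have h' := h.bind fun v => ih.bind_pure fun w => (Fin.cons v w : Fin (N + 1) → α)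
    exact h'.mono le_rfl (by rw [Nat.succ_mul]; omega)

open scoped Classical in
/-- A lower tail bound for the number of successes in independent trials. -/
theorem failure_replicate_le (U : Oracle n a) {p : Prog n a α} {G : α → Prop} {ρ : ℝ}
    (hρ : ρ ≤ 1) (hp : p.failure U (fun v _ => G v) ≤ 1 - ρ) (N T : ℕ) :
    (p.replicate N).failure U (fun w _ => T ≤ ∑ i, if G (w i) then 1 else 0) ≤
      2 ^ T * (1 - ρ / 2) ^ N := by
  -- Exponential Markov inequality: for the number `S` of successes, `Pr[S < T] ≤ 2 ^ T * E[2 ^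
  -- (-S)]`, and each trial contributes a factor of at most `1 - ρ / 2` to the expectation. The
  -- induction peels off one trial.
  have h0 : 0 ≤ 1 - ρ / 2 := by linarith
  induction N generalizing T with
  | zero =>
    refine (failure_le_one U _ _).trans ?_
    simpa using one_le_pow₀ (one_le_two (α := ℝ))
  | succ N ih =>
    have bound : ∀ (S : ℕ) (v : α), T ≤ S + (if G v then 1 else 0) →
        ((p.replicate N).bind fun w => pure (Fin.cons v w : Fin (N + 1) → α)).failure U
          (fun w _ => T ≤ ∑ i, if G (w i) then 1 else 0) ≤ 2 ^ S * (1 - ρ / 2) ^ N := by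
      intro S v hS
      rw [← add_zero (2 ^ S * (1 - ρ / 2) ^ N)]
      refine failure_bind_le U _ _ (ih S) le_rfl fun w q hw => le_of_eq (failure_pure U ?_)
      rw [Fin.sum_univ_succ]
      simp only [Fin.cons_zero, Fin.cons_succ]
      omega
    rcases T with _ | T
    · rw [failure_eq_zero U _ fun _ _ => Nat.zero_le _]
      positivity
    · have h := failure_bind_le_of_le U p
        (fun v => (p.replicate N).bind fun w => pure (Fin.cons v w : Fin (N + 1) → α))
        (P := fun v _ => G v) (Q := fun w _ => T + 1 ≤ ∑ i, if G (w i) then 1 else 0)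
        (b := 2 ^ T * (1 - ρ / 2) ^ N) (b' := 2 ^ (T + 1) * (1 - ρ / 2) ^ N)
        (fun v q hv => bound T v (by simp [hv]))
        (fun v q => bound (T + 1) v (by omega))
      refine le_trans h ?_
      have e : (2 : ℝ) ^ (T + 1) * (1 - ρ / 2) ^ N - 2 ^ T * (1 - ρ / 2) ^ N =
          2 ^ T * (1 - ρ / 2) ^ N := by ring
      rw [e]
      have : 0 ≤ 2 ^ T * (1 - ρ / 2) ^ N := by positivity
      calc _ ≤ 2 ^ T * (1 - ρ / 2) ^ N + (1 - ρ) * (2 ^ T * (1 - ρ / 2) ^ N) := by gcongr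
        _ = 2 ^ (T + 1) * (1 - ρ / 2) ^ (N + 1) := by ring

open scoped Classical in
theorem failure_run_pure (U : Oracle n a) (c : Circuit n a) (f : c.Outcome → α) (G : α → Prop) :
    (run c fun z => pure (f z)).failure U (fun v _ => G v) =
      ∑ z with ¬ G (f z), c.outcomeProb U z := by
  simp only [failure, Finset.sum_filter]
  refine Finset.sum_congr rfl fun z _ => ?_
  by_cases h : G (f z) <;> simp [h]

end Prog

end PMax

namespace PMax

/-! ### Fourier analysis on `ℤ / M` -/

/-- The matrix of the discrete Fourier transform, indexed through an enumeration of the basis. -/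
noncomputable def fourierMatrix {ι : Type*} {M : ℕ} (e : ι ≃ Fin M) : Matrix ι ι ℂ :=
  fun y z => (√(M : ℝ) : ℂ)⁻¹ * Complex.exp (2 * Real.pi * Complex.I / M) ^ ((e y : ℕ) * (e z : ℕ))

/-- Distinct rows are orthogonal because their inner product is a full geometric sum of an `M`-th
root of unity other than `1`. -/
theorem fourierMatrix_mem_unitaryGroup {ι : Type*} [Fintype ι] [DecidableEq ι] {M : ℕ} [NeZero M]
    (e : ι ≃ Fin M) : fourierMatrix e ∈ Matrix.unitaryGroup ι ℂ := by
  have hM : M ≠ 0 := NeZero.ne M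
  have hprim := Complex.isPrimitiveRoot_exp M hM
  set ζ := Complex.exp (2 * Real.pi * Complex.I / M) with hζ
  have hζ0 : ζ ≠ 0 := Complex.exp_ne_zero _
  have hnorm : ‖ζ‖ = 1 := hprim.norm'_eq_one hM
  have hconj : (starRingEnd ℂ) ζ = ζ⁻¹ := by
    rw [Complex.inv_def, Complex.normSq_eq_norm_sq, hnorm]; simp
  have hs : ((√(M : ℝ) : ℂ)⁻¹) * (√(M : ℝ) : ℂ)⁻¹ * M = 1 := by
    rw [← mul_inv, ← Complex.ofReal_mul, Real.mul_self_sqrt (Nat.cast_nonneg M)]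
    simp [hM]
  rw [Matrix.mem_unitaryGroup_iff]
  ext y y'
  have hterm : ∀ z, fourierMatrix e y z * (starRingEnd ℂ) (fourierMatrix e y' z) =
      (√(M : ℝ) : ℂ)⁻¹ * (√(M : ℝ) : ℂ)⁻¹ * (ζ ^ (e y : ℕ) * (ζ ^ (e y' : ℕ))⁻¹) ^ (e z : ℕ) := by
    intro z
    simp only [fourierMatrix, ← hζ, map_mul, map_pow, map_inv₀, Complex.conj_ofReal, hconj]
    rw [mul_pow, ← pow_mul, inv_pow, inv_pow, ← pow_mul]
    ring
  simp only [Matrix.mul_apply, Matrix.star_apply, RCLike.star_def, hterm]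
  rw [← Finset.mul_sum, Equiv.sum_comp e fun i : Fin M =>
    (ζ ^ (e y : ℕ) * (ζ ^ (e y' : ℕ))⁻¹) ^ (i : ℕ), Fin.sum_univ_eq_sum_range]
  by_cases h : y = y'
  · subst h
    rw [mul_inv_cancel₀ (pow_ne_zero _ hζ0)]
    simpa using hs
  · rw [Matrix.one_apply_ne h]
    set r := ζ ^ (e y : ℕ) * (ζ ^ (e y' : ℕ))⁻¹ with hr
    have hr1 : r ≠ 1 := by
      intro h1
      apply h
      rw [hr, mul_inv_eq_one₀ (pow_ne_zero _ hζ0)] at h1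
      exact e.injective (Fin.ext (hprim.pow_inj (e y).2 (e y').2 h1))
    have hrM : r ^ M = 1 := by
      rw [hr, mul_pow, inv_pow, ← pow_mul, ← pow_mul, mul_comm _ M, mul_comm _ M, pow_mul, pow_mul,
        hprim.pow_eq_one]
      simp
    have := geom_sum_mul r M
    rw [hrM, sub_self, mul_eq_zero] at this
    rw [this.resolve_right (sub_ne_zero.2 hr1), mul_zero]

/-- The unnormalized triangular window. -/
def triangle (M z : ℕ) : ℕ := min z (M - z)

/-- The triangular window, normalized in `ℓ²`. -/
noncomputable def window (M z : ℕ) : ℝ :=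
  triangle M z / √(∑ i ∈ Finset.range M, (triangle M i : ℝ) ^ 2)

theorem le_sum_triangle_sq (L : ℕ) :
    2 * (L : ℝ) ^ 3 ≤ ∑ i ∈ Finset.range (4 * L), (triangle (4 * L) i : ℝ) ^ 2 := by
  -- On the middle half of the range, of length `2 * L`, the triangle has height at least `L`.
  calc 2 * (L : ℝ) ^ 3 = ∑ i ∈ Finset.Ico L (3 * L), (L : ℝ) ^ 2 := by
        rw [Finset.sum_const, Nat.card_Ico, show 3 * L - L = 2 * L by omega]
        simp; ring
    _ ≤ ∑ i ∈ Finset.Ico L (3 * L), (triangle (4 * L) i : ℝ) ^ 2 := by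
        refine Finset.sum_le_sum fun i hi => ?_
        rw [Finset.mem_Ico] at hi
        have : L ≤ triangle (4 * L) i := by unfold triangle; omega
        gcongr
    _ ≤ _ := by
        refine Finset.sum_le_sum_of_subset_of_nonneg (fun i hi => ?_) fun _ _ _ => sq_nonneg _
        rw [Finset.mem_Ico] at hi
        rw [Finset.mem_range]
        omega

theorem sum_window_sq {L : ℕ} (hL : 0 < L) :
    ∑ z ∈ Finset.range (4 * L), window (4 * L) z ^ 2 = 1 := by
  have h := le_sum_triangle_sq L
  have hL' : (0 : ℝ) < L := Nat.cast_pos.2 hL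
  have h0 : 0 < ∑ i ∈ Finset.range (4 * L), (triangle (4 * L) i : ℝ) ^ 2 :=
    lt_of_lt_of_le (by positivity) h
  simp only [window, div_pow, ← Finset.sum_div, Real.sq_sqrt h0.le]
  exact div_self h0.ne'

/-- The triangle has slopes at most `1` in absolute value, so its squared differences sum to at most
`M = 4 * L`, against a squared norm of at least `2 * L ^ 3`. -/
theorem sum_window_sub_sq_le {L : ℕ} (hL : 0 < L) :
    ∑ z ∈ Finset.range (4 * L), (window (4 * L) (z + 1) - window (4 * L) z) ^ 2 ≤
      32 / ((4 * L : ℕ) : ℝ) ^ 2 := by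
  have h := le_sum_triangle_sq L
  have hL' : (0 : ℝ) < L := Nat.cast_pos.2 hL
  have h0 : 0 < ∑ i ∈ Finset.range (4 * L), (triangle (4 * L) i : ℝ) ^ 2 :=
    lt_of_lt_of_le (by positivity) h
  simp only [window, ← sub_div, div_pow, ← Finset.sum_div, Real.sq_sqrt h0.le]
  have hnum : ∑ i ∈ Finset.range (4 * L),
      ((triangle (4 * L) (i + 1) : ℝ) - triangle (4 * L) i) ^ 2 ≤ 4 * L := by
    calc _ ≤ ∑ i ∈ Finset.range (4 * L), (1 : ℝ) := by
          refine Finset.sum_le_sum fun i hi => ?_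
          rw [Finset.mem_range] at hi
          have h1 : triangle (4 * L) (i + 1) ≤ triangle (4 * L) i + 1 := by unfold triangle; omega
          have h2 : triangle (4 * L) i ≤ triangle (4 * L) (i + 1) + 1 := by unfold triangle; omega
          have h1' : (triangle (4 * L) (i + 1) : ℝ) ≤ triangle (4 * L) i + 1 := by exact_mod_cast h1
          have h2' : (triangle (4 * L) i : ℝ) ≤ triangle (4 * L) (i + 1) + 1 := by exact_mod_cast h2
          rw [sq_le_one_iff_abs_le_one, abs_le]
          constructor <;> linarith
      _ = 4 * L := by simp
  rw [div_le_div_iff₀ h0 (by positivity)]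
  push_cast
  calc _ ≤ 4 * (L : ℝ) * (4 * L) ^ 2 := by gcongr
    _ = 32 * (2 * (L : ℝ) ^ 3) := by ring
    _ ≤ _ := by gcongr

/-- Summation by parts; the window vanishes at both `0` and `M`, so there is no boundary term. -/
theorem one_sub_mul_sum_window (M : ℕ) (r : ℂ) :
    (1 - r) * ∑ z ∈ Finset.range M, r ^ z * window M z =
      r * ∑ z ∈ Finset.range M, r ^ z * ((window M (z + 1) - window M z : ℝ) : ℂ) := by
  have h0 : window M 0 = 0 := by simp [window, triangle]
  have hM : window M M = 0 := by simp [window, triangle]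
  have h1 := Finset.sum_range_succ (fun z => r ^ z * (window M z : ℂ)) M
  have h2 := Finset.sum_range_succ' (fun z => r ^ z * (window M z : ℂ)) M
  rw [h1, hM, h0] at h2
  simp only [Complex.ofReal_sub, mul_sub, Finset.sum_sub_distrib, Complex.ofReal_zero, mul_zero,
    add_zero] at h2 ⊢
  rw [sub_mul, one_mul]
  congr 1
  rw [h2, Finset.mul_sum]
  exact Finset.sum_congr rfl fun z _ => by ring

/-- The Fourier coefficients of the window, modulated with frequency `φ / π`, have second moment
`O(1 / M ^ 2)`. -/
theorem second_moment_le {ι : Type*} [Fintype ι] [DecidableEq ι] {M L : ℕ} (hL : 0 < L)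
    (hML : M = 4 * L) (e : ι ≃ Fin M) (φ : ℝ) :
    ∑ y, 4 * Real.sin (Real.pi * (e y : ℕ) / M + φ) ^ 2 *
      ‖∑ z, fourierMatrix e y z *
        (window M (e z) * Complex.exp (2 * φ * Complex.I) ^ (e z : ℕ))‖ ^ 2 ≤ 32 / (M : ℝ) ^ 2 := by
  have hM : M ≠ 0 := by omega
  have : NeZero M := ⟨hM⟩
  have hw := sum_window_sub_sq_le hL
  rw [← hML] at hw
  refine le_trans (le_of_eq ?_) hw
  set d : ι → ℂ := fun z => ((window M (e z + 1) - window M (e z) : ℝ) : ℂ) *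
    Complex.exp (2 * φ * Complex.I) ^ (e z : ℕ) with hd
  have hc : ‖Complex.exp (2 * φ * Complex.I)‖ = 1 := by
    have := Complex.norm_exp_ofReal_mul_I (2 * φ)
    push_cast at this
    exact this
  have hpars := sum_norm_sq_mulVec (fourierMatrix_mem_unitaryGroup e) d
  have hdn : ∑ z, ‖d z‖ ^ 2 = ∑ z ∈ Finset.range M, (window M (z + 1) - window M z) ^ 2 := by
    rw [← Fin.sum_univ_eq_sum_range (fun z => (window M (z + 1) - window M z) ^ 2),
      ← Equiv.sum_comp e]
    refine Finset.sum_congr rfl fun z _ => ?_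
    rw [hd]
    simp only [norm_mul, norm_pow, hc, one_pow, mul_one, Complex.norm_real, Real.norm_eq_abs,
      sq_abs]
  rw [← hdn, ← hpars]
  refine Finset.sum_congr rfl fun y _ => ?_
  -- `r` is the ratio of the geometric progression that the window is summed against. The weight `4
  -- * sin ^ 2` is `‖1 - r‖ ^ 2`, so summation by parts turns each term into a squared Fourier
  -- coefficient of `d`, and Parseval applies.
  set r : ℂ := Complex.exp (2 * Real.pi * Complex.I / M) ^ (e y : ℕ) *
    Complex.exp (2 * φ * Complex.I) with hr
  have hsum : ∀ w : ℕ → ℝ, ∑ z, fourierMatrix e y z *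
      ((w (e z) : ℂ) * Complex.exp (2 * φ * Complex.I) ^ (e z : ℕ)) =
      (√(M : ℝ) : ℂ)⁻¹ * ∑ z ∈ Finset.range M, r ^ z * (w z : ℂ) := by
    intro w
    rw [← Fin.sum_univ_eq_sum_range (fun z => r ^ z * (w z : ℂ)), ← Equiv.sum_comp e,
      Finset.mul_sum]
    refine Finset.sum_congr rfl fun z _ => ?_
    rw [fourierMatrix, hr, mul_pow, pow_mul]
    ring
  have hr' : r = Complex.exp (Complex.I * (2 * (Real.pi * (e y : ℕ) / (M : ℕ) + φ) : ℝ)) := by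
    rw [hr, ← Complex.exp_nat_mul, ← Complex.exp_add]
    congr 1
    push_cast
    ring
  have hr1 : ‖r‖ = 1 := by rw [hr', Complex.norm_exp_I_mul_ofReal]
  have hr2 : ‖1 - r‖ ^ 2 = 4 * Real.sin (Real.pi * (e y : ℕ) / (M : ℕ) + φ) ^ 2 := by
    rw [norm_sub_rev, hr', Complex.norm_exp_I_mul_ofReal_sub_one, Real.norm_eq_abs, sq_abs,
      mul_div_cancel_left₀ _ (two_ne_zero)]
    ring
  have hmain : ∀ z, (Matrix.mulVec (fourierMatrix e) d) z = ∑ x, fourierMatrix e z x * d x :=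
    fun z => rfl
  rw [hmain, hd, ← hr2]
  rw [hsum (window M), hsum fun z => window M (z + 1) - window M z, ← mul_pow, ← norm_mul]
  rw [mul_left_comm, one_sub_mul_sum_window, mul_left_comm, norm_mul r, hr1, one_mul]

/-- Extend `v` to an orthonormal basis with `v` at index `i₀`; the change of basis is the required
gate. -/
theorem exists_unitary_mulVec_single {ι : Type*} [Fintype ι] [DecidableEq ι] (i₀ : ι) (v : ι → ℂ)
    (hv : ∑ i, ‖v i‖ ^ 2 = 1) :
    ∃ W : Matrix.unitaryGroup ι ℂ, W.1.mulVec (Pi.single i₀ 1) = v := by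
  set u : EuclideanSpace ℂ ι := WithLp.toLp 2 v
  have hu : ‖u‖ = 1 := by
    rw [EuclideanSpace.norm_eq, Real.sqrt_eq_one]
    exact hv
  have horth : Orthonormal ℂ (({i₀} : Set ι).domRestrict fun _ => u) := by
    constructor
    · intro i; exact hu
    · intro i j hij; exact absurd (Subsingleton.elim i j) hij
  obtain ⟨b, hb⟩ := horth.exists_orthonormalBasis_extension_of_card_eq (by simp)
  refine ⟨⟨_, (EuclideanSpace.basisFun ι ℂ).toMatrix_orthonormalBasis_mem_unitary b⟩, ?_⟩
  ext i
  rw [Matrix.mulVec_single_one, Matrix.col_apply]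
  change (EuclideanSpace.basisFun ι ℂ).toBasis.toMatrix b i i₀ = v i
  rw [Module.Basis.toMatrix_apply, hb i₀ rfl]
  simp [u]

end PMax

namespace PMax

/-! ### Amplitude estimation -/

/-- The gate that flips the sign of the basis states in `S`. -/
noncomputable def signGate {ι : Type*} [Fintype ι] [DecidableEq ι] (S : ι → Prop)
    [DecidablePred S] : Matrix.unitaryGroup ι ℂ :=
  ⟨Matrix.diagonal fun w => if S w then -1 else 1, by
    rw [Matrix.mem_unitaryGroup_iff, Matrix.star_eq_conjTranspose, Matrix.diagonal_conjTranspose,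
      Matrix.diagonal_mul_diagonal, ← Matrix.diagonal_one]
    congr 1
    ext w
    by_cases h : S w <;> simp [h]⟩

theorem signGate_mulVec {ι : Type*} [Fintype ι] [DecidableEq ι] (S : ι → Prop) [DecidablePred S]
    (f : ι → ℂ) (w : ι) : (signGate S).1.mulVec f w = (if S w then -1 else 1) * f w := by
  simp [signGate, Matrix.mulVec_diagonal]

/-- A gate that acts on the additional qubits of the workspace. -/
noncomputable def extraGate (n a : ℕ) {b : ℕ} (B : Matrix.unitaryGroup (Bits b) ℂ) :
    Matrix.unitaryGroup (Work n a b) ℂ :=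
  ⟨(1 : Matrix (Bits n × Bits a) (Bits n × Bits a) ℂ) ⊗ₖ B.1,
    Matrix.kronecker_mem_unitary (one_mem _) B.2⟩

theorem extraGate_mulVec {n a b : ℕ} (B : Matrix.unitaryGroup (Bits b) ℂ) (f : Work n a b → ℂ)
    (w : Bits n × Bits a) (z : Bits b) :
    (extraGate n a B).1.mulVec f (w, z) = B.1.mulVec (fun z' => f (w, z')) z := by
  simp [extraGate, Matrix.mulVec, dotProduct, Fintype.sum_prod_type (α₁ := Bits n × Bits a),
    Matrix.one_apply, ite_mul]

theorem queryOp_mulVec {n a b : ℕ} (U : Oracle n a) (inverse : Bool) (f : Work n a b → ℂ)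
    (w : Bits n × Bits a) (z : Bits b) :
    (queryOp U b inverse).mulVec f (w, z) =
      (if inverse then U.1.conjTranspose else U.1).mulVec (fun w' => f (w', z)) w := by
  simp [queryOp, Matrix.mulVec, dotProduct, Fintype.sum_prod_type (α₁ := Bits n × Bits a),
    Matrix.one_apply, mul_ite]

/-- An enumeration of the basis states of `k` qubits. -/
noncomputable def bitsEquiv (k : ℕ) : Bits k ≃ Fin (2 ^ k) :=
  Fintype.equivFinOfCardEq (by simp)

/-- `J` Grover iterations for the outcome `x`; iteration `j` is controlled on the condition that
the number in the additional register exceeds `j`. -/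
noncomputable def groverSteps {n : ℕ} (a : ℕ) (x : Bits n) (k : ℕ) :
    ℕ → List (Bool × Matrix.unitaryGroup (Work n a k) ℂ)
  | 0 => []
  | j + 1 => groverSteps a x k j ++
      [(true, signGate fun w => j < (bitsEquiv k w.2 : ℕ) ∧ w.1 ≠ (zeros n, zeros a)),
        (false, signGate fun w => j < (bitsEquiv k w.2 : ℕ) ∧ w.1.1 = x)]

/-- Phase estimation for the Grover iteration, with initial state `W` and final transformation `F`
of the additional register. -/
noncomputable def phaseCircuit {n : ℕ} (a : ℕ) (x : Bits n) (k : ℕ)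
    (W F : Matrix.unitaryGroup (Bits k) ℂ) : Circuit n a where
  extra := k
  init := extraGate n a W
  steps := (false, 1) :: (groverSteps a x k (2 ^ k) ++ [(true, 1), (false, extraGate n a F)])

theorem phaseCircuit_queries {n : ℕ} (a : ℕ) (x : Bits n) (k : ℕ)
    (W F : Matrix.unitaryGroup (Bits k) ℂ) :
    (phaseCircuit a x k W F).queries = 2 * 2 ^ k + 3 := by
  have h : ∀ j, (groverSteps a x k j).length = 2 * j := by
    intro j
    induction j with
    | zero => rfl
    | succ j ih => simp [groverSteps, ih]; ring
  have h' : (((false, 1) :: (groverSteps a x k (2 ^ k) ++ [(true, 1), (false, extraGate n a F)]) :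
      List (Bool × Matrix.unitaryGroup (Work n a k) ℂ))).length = 2 * 2 ^ k + 3 := by
    simp only [List.length_cons, List.length_append, h, List.length_nil]
  exact h'

/-! ### The plane of the Grover iteration -/

section GroverPlane

variable {n a : ℕ} (U : Oracle n a) (x : Bits n)

/-- The angle `θ` with `sin θ ^ 2 = p_x`. -/
noncomputable def groverAngle : ℝ := Real.arcsin √(outputProb U x)

theorem sin_groverAngle : Real.sin (groverAngle U x) = √(outputProb U x) :=
  Real.sin_arcsin (by linarith [Real.sqrt_nonneg (outputProb U x)])
    (Real.sqrt_le_one.2 (outputProb_le_one U x))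

theorem cos_groverAngle : Real.cos (groverAngle U x) = √(1 - outputProb U x) := by
  rw [groverAngle, Real.cos_arcsin, Real.sq_sqrt (outputProb_nonneg U x)]

/-- The state `O_D |0⟩`. -/
noncomputable def oracleState (w : Bits n × Bits a) : ℂ := U.1 w (zeros n, zeros a)

/-- The vector with angle `α` in the plane spanned by the projections of `O_D |0⟩` to the states
with first register `x` and to the others. -/
noncomputable def groverVec (α : ℝ) (w : Bits n × Bits a) : ℂ :=
  if w.1 = x then ((Real.sin α / √(outputProb U x) : ℝ) : ℂ) * oracleState U w
  else ((Real.cos α / √(1 - outputProb U x) : ℝ) : ℂ) * oracleState U w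

theorem sum_good : ∑ w : Bits n × Bits a with w.1 = x, ‖oracleState U w‖ ^ 2 = outputProb U x := by
  rw [Finset.sum_filter, Fintype.sum_prod_type, Finset.sum_comm]
  simp [outputProb, oracleState]

theorem sum_bad :
    ∑ w : Bits n × Bits a with ¬ w.1 = x, ‖oracleState U w‖ ^ 2 = 1 - outputProb U x := by
  rw [eq_sub_iff_add_eq, ← sum_good U x, add_comm, Finset.sum_filter_add_sum_filter_not,
    ← sum_outputProb U, Fintype.sum_prod_type]
  rfl

/-- If `p_x` is `0` or `1`, one of the denominators in `groverVec` is zero, but then the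
corresponding component of the oracle state vanishes as well. -/
theorem groverVec_groverAngle : groverVec U x (groverAngle U x) = oracleState U := by
  ext w
  have key : ∀ (S : Finset (Bits n × Bits a)) (p : ℝ), ∑ w ∈ S, ‖oracleState U w‖ ^ 2 = p →
      w ∈ S → ((√p / √p : ℝ) : ℂ) * oracleState U w = oracleState U w := by
    intro S p hS hw
    by_cases hp : √p = 0
    · have h0 : p ≤ 0 := Real.sqrt_eq_zero'.1 hp
      have h1 : ‖oracleState U w‖ ^ 2 ≤ 0 := by
        refine le_trans ?_ h0
        rw [← hS]
        exact Finset.single_le_sum (f := fun w => ‖oracleState U w‖ ^ 2)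
          (fun _ _ => sq_nonneg _) hw
      have h2 : oracleState U w = 0 := by
        rw [← norm_eq_zero]
        exact pow_eq_zero_iff (two_ne_zero) |>.1 (le_antisymm h1 (sq_nonneg _))
      simp [h2]
    · rw [div_self hp, Complex.ofReal_one, one_mul]
  unfold groverVec
  rw [sin_groverAngle, cos_groverAngle]
  split_ifs with h
  · exact key _ _ (sum_good U x) (by simpa using h)
  · exact key _ _ (sum_bad U x) (by simpa using h)

theorem sum_star_mul_groverVec (α : ℝ) :
    ∑ w, star (oracleState U w) * groverVec U x α w =
      (Real.cos (α - groverAngle U x) : ℝ) := by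
  rw [← Finset.sum_filter_add_sum_filter_not _ fun w : Bits n × Bits a => w.1 = x]
  have h1 : ∑ w : Bits n × Bits a with w.1 = x, star (oracleState U w) * groverVec U x α w =
      ((Real.sin α / √(outputProb U x) * outputProb U x : ℝ) : ℂ) := by
    have hp := congrArg (fun r : ℝ => (r : ℂ)) (sum_good U x)
    simp only [Complex.ofReal_sum] at hp
    rw [Complex.ofReal_mul, ← hp, Finset.mul_sum]
    refine Finset.sum_congr rfl fun w hw => ?_
    rw [groverVec, if_pos (by simpa using hw), Complex.ofReal_pow, ← Complex.conj_mul']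
    simp only [RCLike.star_def]
    ring
  have h2 : ∑ w : Bits n × Bits a with ¬ w.1 = x, star (oracleState U w) * groverVec U x α w =
      ((Real.cos α / √(1 - outputProb U x) * (1 - outputProb U x) : ℝ) : ℂ) := by
    have hp := congrArg (fun r : ℝ => (r : ℂ)) (sum_bad U x)
    simp only [Complex.ofReal_sum] at hp
    rw [Complex.ofReal_mul, ← hp, Finset.mul_sum]
    refine Finset.sum_congr rfl fun w hw => ?_
    rw [groverVec, if_neg (by simpa using hw), Complex.ofReal_pow, ← Complex.conj_mul']
    simp only [RCLike.star_def]
    ring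
  rw [h1, h2, ← Complex.ofReal_add, Real.cos_sub, sin_groverAngle, cos_groverAngle,
    div_mul_eq_mul_div, div_mul_eq_mul_div, mul_div_assoc, mul_div_assoc, Real.div_sqrt,
    Real.div_sqrt, add_comm]

/-- The sign flip off the zero state is `2|0⟩⟨0| - 1`; conjugation by the oracle turns it into the
reflection about `O_D |0⟩`. -/
theorem mulVec_reflection (v : Bits n × Bits a → ℂ) (w : Bits n × Bits a) :
    U.1.mulVec (fun w' => (if w' ≠ (zeros n, zeros a) then -1 else 1) *
      U.1.conjTranspose.mulVec v w') w =
      2 * (∑ w, star (oracleState U w) * v w) * oracleState U w - v w := by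
  have h : (fun w' => (if w' ≠ (zeros n, zeros a) then -1 else 1) *
      U.1.conjTranspose.mulVec v w') =
      (2 * ∑ w, star (oracleState U w) * v w) • Pi.single (zeros n, zeros a) (1 : ℂ) -
        U.1.conjTranspose.mulVec v := by
    ext w'
    by_cases hw : w' = (zeros n, zeros a)
    · subst hw
      simp [Matrix.mulVec, dotProduct, oracleState]
      ring
    · simp [hw]
  rw [h, Matrix.mulVec_sub, Matrix.mulVec_smul, Matrix.mulVec_mulVec,
    ← Matrix.star_eq_conjTranspose, Matrix.mem_unitaryGroup_iff.1 U.2, Matrix.one_mulVec,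
    Matrix.mulVec_single_one]
  simp [oracleState]

/-- One Grover iteration is a rotation by twice the Grover angle. -/
theorem groverVec_step (α : ℝ) (w : Bits n × Bits a) :
    (if w.1 = x then -1 else 1) *
      (2 * (∑ w, star (oracleState U w) * groverVec U x α w) * oracleState U w -
        groverVec U x α w) = groverVec U x (α - 2 * groverAngle U x) w := by
  rw [sum_star_mul_groverVec]
  have hψ := congrFun (groverVec_groverAngle U x) w
  set θ := groverAngle U x
  rw [← hψ]
  have hs : Real.sin (α - 2 * θ) = Real.sin α - 2 * Real.cos (α - θ) * Real.sin θ := by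
    have h1 : Real.sin α = Real.sin ((α - θ) + θ) := by ring_nf
    have h2 : Real.sin (α - 2 * θ) = Real.sin ((α - θ) - θ) := by ring_nf
    rw [h1, h2, Real.sin_add, Real.sin_sub]
    ring
  have hc : Real.cos (α - 2 * θ) = 2 * Real.cos (α - θ) * Real.cos θ - Real.cos α := by
    have h1 : Real.cos α = Real.cos ((α - θ) + θ) := by ring_nf
    have h2 : Real.cos (α - 2 * θ) = Real.cos ((α - θ) - θ) := by ring_nf
    rw [h1, h2, Real.cos_add, Real.cos_sub]
    ring
  by_cases h : w.1 = x
  · simp only [groverVec, h, if_true, hs]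
    push_cast
    ring
  · simp only [groverVec, h, if_false, hc]
    push_cast
    ring

end GroverPlane

end PMax

namespace PMax

/-! ### Phase estimation for the Grover rotation -/

section PhaseEstimation

variable {n a : ℕ} (U : Oracle n a) (x : Bits n)

/-- On the branch with counter `z`, only the iterations `j < z` rotate; in all others the sign gates
are trivial and the two queries cancel. So `min J z` rotations by `-2θ` act on the initial angle
`θ`. -/
theorem foldl_groverSteps (k : ℕ) (c : Bits k → ℂ) (J : ℕ) :
    (groverSteps a x k J).foldl (fun ψ s => s.2.1.mulVec ((queryOp U k s.1).mulVec ψ))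
      (fun w => c w.2 * oracleState U w.1) =
    fun w => c w.2 * groverVec U x
      ((1 - 2 * (min J (bitsEquiv k w.2 : ℕ) : ℕ)) * groverAngle U x) w.1 := by
  induction J with
  | zero => simp [groverSteps, groverVec_groverAngle]
  | succ J ih =>
    rw [groverSteps, List.foldl_append, ih]
    ext ⟨w, z⟩
    set α := (1 - 2 * ((min J (bitsEquiv k z : ℕ) : ℕ) : ℝ)) * groverAngle U x with hα
    have hlin : ∀ (A : Matrix (Bits n × Bits a) (Bits n × Bits a) ℂ) (d : ℂ)
        (g : Bits n × Bits a → ℂ) (v : Bits n × Bits a),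
        A.mulVec (fun w' => d * g w') v = d * A.mulVec g v := fun A d g v =>
      congrFun (A.mulVec_smul d g) v
    simp only [List.foldl_cons, List.foldl_nil, signGate_mulVec, queryOp_mulVec, if_true,
      Bool.false_eq_true, if_false, hlin, ← hα]
    by_cases hJ : J < (bitsEquiv k z : ℕ)
    · simp only [hJ, true_and]
      have h := groverVec_step U x α w
      have h2 : ∀ w' : Bits n × Bits a, (if w' ≠ (zeros n, zeros a) then (-1 : ℂ) else 1) *
          (c z * U.1.conjTranspose.mulVec (groverVec U x α) w') =
          c z * ((if w' ≠ (zeros n, zeros a) then -1 else 1) *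
            U.1.conjTranspose.mulVec (groverVec U x α) w') := fun _ => mul_left_comm _ _ _
      simp only [h2, hlin, mulVec_reflection]
      rw [mul_left_comm, h]
      congr 2
      rw [hα, min_eq_left hJ.le, min_eq_left (Nat.succ_le_of_lt hJ)]
      push_cast
      ring
    · simp only [hJ, false_and, if_false, one_mul, hlin]
      rw [Matrix.mulVec_mulVec, ← Matrix.star_eq_conjTranspose, Matrix.mem_unitaryGroup_iff.1 U.2,
        Matrix.one_mulVec, hα, min_eq_right (not_lt.1 hJ),
        min_eq_right ((not_lt.1 hJ).trans (Nat.le_succ _))]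

/-- The final state of phase estimation. -/
theorem phaseCircuit_finalState (k : ℕ) (W F : Matrix.unitaryGroup (Bits k) ℂ) (c : Bits k → ℂ)
    (hW : W.1.mulVec (Pi.single (zeros k) 1) = c) (w : Bits n × Bits a) (y : Bits k) :
    (phaseCircuit a x k W F).finalState U (w, y) =
      ∑ z, F.1 y z * (c z * groverVec U x
        ((1 - 2 * (bitsEquiv k z : ℕ)) * groverAngle U x) w) := by
  have hinit : (extraGate n a W).1.mulVec (Pi.single ((zeros n, zeros a), zeros k) 1) =
      fun w : Work n a k => c w.2 * (Pi.single (zeros n, zeros a) 1 : _ → ℂ) w.1 := by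
    ext ⟨w, z⟩
    rw [extraGate_mulVec]
    by_cases hw : w = (zeros n, zeros a)
    · subst hw
      rw [Pi.single_eq_same, mul_one, ← hW]
      congr 1
      ext z'
      by_cases hz : z' = zeros k
      · subst hz; simp
      · simp [hz]
    · have : (fun z' : Bits k => (Pi.single ((zeros n, zeros a), zeros k) 1 : Work n a k → ℂ)
          (w, z')) = 0 := by
        ext z'
        simp [hw]
      rw [this, Matrix.mulVec_zero]
      simp [hw]
  have hfirst : (1 : Matrix.unitaryGroup (Work n a k) ℂ).1.mulVec ((queryOp U k false).mulVec
      fun w : Work n a k => c w.2 * (Pi.single (zeros n, zeros a) 1 : _ → ℂ) w.1) =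
      fun w => c w.2 * oracleState U w.1 := by
    ext ⟨w, z⟩
    rw [OneMemClass.coe_one, Matrix.one_mulVec, queryOp_mulVec]
    have := congrFun (U.1.mulVec_smul (c z) (Pi.single (zeros n, zeros a) 1)) w
    refine this.trans ?_
    rw [Pi.smul_apply, Matrix.mulVec_single_one]
    rfl
  unfold Circuit.finalState
  change (List.foldl (fun ψ s => s.2.1.mulVec ((queryOp U k s.1).mulVec ψ))
    ((extraGate n a W).1.mulVec (Pi.single ((zeros n, zeros a), zeros k) 1 : Work n a k → ℂ))
    (_ :: (groverSteps a x k (2 ^ k) ++ _))) (w, y) = _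
  rw [hinit, List.foldl_cons, hfirst, List.foldl_append, foldl_groverSteps]
  simp only [List.foldl_cons, List.foldl_nil]
  -- Gates only occur after queries, so `F` is attached to a final pair of mutually inverse queries.
  have hinv : ∀ f : Work n a k → ℂ, (queryOp U k false).mulVec
      ((1 : Matrix.unitaryGroup (Work n a k) ℂ).1.mulVec ((queryOp U k true).mulVec f)) = f := by
    intro f
    ext ⟨w, z⟩
    rw [OneMemClass.coe_one, Matrix.one_mulVec, queryOp_mulVec]
    simp only [queryOp_mulVec, if_true, Bool.false_eq_true, if_false]
    rw [Matrix.mulVec_mulVec, ← Matrix.star_eq_conjTranspose, Matrix.mem_unitaryGroup_iff.1 U.2,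
      Matrix.one_mulVec]
  rw [hinv, extraGate_mulVec]
  refine Finset.sum_congr rfl fun z _ => ?_
  dsimp only
  rw [min_eq_right (bitsEquiv k z).2.le]

/-- The components in and outside the outcome `x` carry the sine and cosine sums; the parallelogram
law rewrites these through the two eigenphases `±α`. Equality can fail only if `p_x` is `0` or `1`,
where one component is lost. -/
theorem sum_norm_sq_combination_le {ι : Type*} [Fintype ι] (d : ι → ℂ) (α : ι → ℝ) :
    ∑ w, ‖∑ z, d z * groverVec U x (α z) w‖ ^ 2 ≤
      (‖∑ z, d z * Complex.exp (α z * Complex.I)‖ ^ 2 +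
        ‖∑ z, d z * Complex.exp (-(α z * Complex.I))‖ ^ 2) / 2 := by
  set S := ∑ z, d z * (Real.sin (α z) : ℂ) with hS
  set K := ∑ z, d z * (Real.cos (α z) : ℂ) with hK
  have hp : ∑ z, d z * Complex.exp (α z * Complex.I) = K + S * Complex.I := by
    rw [hK, hS, Finset.sum_mul, ← Finset.sum_add_distrib]
    refine Finset.sum_congr rfl fun z _ => ?_
    rw [Complex.exp_mul_I, ← Complex.ofReal_cos, ← Complex.ofReal_sin]
    ring
  have hm : ∑ z, d z * Complex.exp (-(α z * Complex.I)) = K - S * Complex.I := by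
    rw [hK, hS, Finset.sum_mul, ← Finset.sum_sub_distrib]
    refine Finset.sum_congr rfl fun z _ => ?_
    rw [← neg_mul, Complex.exp_mul_I, Complex.cos_neg, Complex.sin_neg, ← Complex.ofReal_cos,
      ← Complex.ofReal_sin]
    ring
  rw [hp, hm, parallelogram_law_with_norm ℝ, norm_mul, Complex.norm_I, mul_one,
    mul_div_cancel_left₀ _ (two_ne_zero)]
  have part : ∀ (T : Finset (Bits n × Bits a)) (p : ℝ) (s : ℂ) (f : Bits n × Bits a → ℂ),
      ∑ w ∈ T, ‖oracleState U w‖ ^ 2 = p → 0 ≤ p →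
      (∀ w ∈ T, f w = s * ((1 / √p : ℝ) : ℂ) * oracleState U w) →
      ∑ w ∈ T, ‖f w‖ ^ 2 ≤ ‖s‖ ^ 2 := by
    intro T p s f hT hp hf
    rw [Finset.sum_congr rfl fun w hw => by rw [hf w hw]]
    simp only [norm_mul, mul_pow, ← Finset.mul_sum, hT]
    rw [Complex.norm_real, Real.norm_eq_abs, sq_abs, div_pow, Real.sq_sqrt hp, one_pow, mul_assoc]
    refine mul_le_of_le_one_right (sq_nonneg _) ?_
    rw [one_div_mul_eq_div]
    exact div_self_le_one p
  rw [← Finset.sum_filter_add_sum_filter_not _ fun w : Bits n × Bits a => w.1 = x, add_comm]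
  refine add_le_add (part _ _ K _ (sum_bad U x) (sub_nonneg.2 (outputProb_le_one U x)) ?_)
    (part _ _ S _ (sum_good U x) (outputProb_nonneg U x) ?_)
  · intro w hw
    rw [hK, Finset.sum_mul, Finset.sum_mul]
    refine Finset.sum_congr rfl fun z _ => ?_
    rw [groverVec, if_neg (by simpa using hw)]
    push_cast
    ring
  · intro w hw
    rw [hS, Finset.sum_mul, Finset.sum_mul]
    refine Finset.sum_congr rfl fun z _ => ?_
    rw [groverVec, if_pos (by simpa using hw)]
    push_cast
    ring

/-- Phase estimation sees `θ` only up to sign and modulo `π`. Passing to `|sin|` removes both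
ambiguities without increasing the error. -/
theorem abs_abs_sin_sub_abs_sin_le (α β : ℝ) :
    |(|Real.sin α| - |Real.sin β|)| ≤ |Real.sin (α - β)| := by
  have key : ∀ α β : ℝ, |Real.sin α| ≤ |Real.sin β| + |Real.sin (α - β)| := by
    intro α β
    have h : Real.sin α = Real.sin (α - β) * Real.cos β + Real.cos (α - β) * Real.sin β := by
      rw [← Real.sin_add, sub_add_cancel]
    rw [h]
    refine (abs_add_le _ _).trans ?_
    rw [abs_mul, abs_mul, add_comm]
    exact add_le_add (mul_le_of_le_one_left (abs_nonneg _) (Real.abs_cos_le_one _))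
      (mul_le_of_le_one_right (abs_nonneg _) (Real.abs_cos_le_one _))
  rw [abs_le]
  have h1 := key α β
  have h2 := key β α
  rw [← neg_sub, Real.sin_neg, abs_neg] at h2
  constructor <;> linarith

/-- One run of amplitude estimation. -/
theorem exists_amplitudeTrial (a : ℕ) (x : Bits n) {k : ℕ} (hk : 2 ≤ k) :
    ∃ p : Prog n a ℝ, p.Bounded (n + a + k) (2 * 2 ^ k + 3) ∧
      ∀ U, p.failure U (fun v _ => |v - √(outputProb U x)| ≤ 12 / 2 ^ k) ≤ 1 / 18 := by
  obtain ⟨l, rfl⟩ := Nat.exists_eq_add_of_le hk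
  set k := 2 + l
  set L := 2 ^ l with hLdef
  have hL : 0 < L := by positivity
  have hML : 2 ^ k = 4 * L := by simp only [k, hLdef, pow_add]; norm_num
  have hsum : ∑ z : Bits k, ‖((window (2 ^ k) (bitsEquiv k z) : ℝ) : ℂ)‖ ^ 2 = 1 := by
    have h := sum_window_sq hL
    rw [← hML, ← Fin.sum_univ_eq_sum_range (fun z => window (2 ^ k) z ^ 2),
      ← Equiv.sum_comp (bitsEquiv k)] at h
    rw [← h]
    refine Finset.sum_congr rfl fun z _ => ?_
    rw [Complex.norm_real, Real.norm_eq_abs, sq_abs]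
  obtain ⟨W, hW⟩ := exists_unitary_mulVec_single (zeros k) _ hsum
  have : NeZero (2 ^ k) := ⟨by positivity⟩
  set F : Matrix.unitaryGroup (Bits k) ℂ := ⟨_, fourierMatrix_mem_unitaryGroup (bitsEquiv k)⟩
  set c := phaseCircuit a x k W F with hc
  refine ⟨.run c fun o => .pure |Real.sin (Real.pi * (bitsEquiv k o.2 : ℕ) / (2 ^ k : ℕ))|,
    ⟨le_rfl, (phaseCircuit_queries a x k W F).le, fun z => trivial⟩, fun U => ?_⟩
  rw [Prog.failure_run_pure]
  set θ := groverAngle U x with hθ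
  set A : Bits k → ℝ → ℝ := fun y φ => ‖∑ z, fourierMatrix (bitsEquiv k) y z *
        (window (2 ^ k) (bitsEquiv k z) *
          Complex.exp (2 * φ * Complex.I) ^ (bitsEquiv k z : ℕ))‖ ^ 2 with hA
  set P : Work n a k → ℝ := fun o => c.outcomeProb U o with hP
  set β : Bits k → ℝ := fun y => Real.pi * (bitsEquiv k y : ℕ) / (2 ^ k : ℕ) with hβ
  have hAnn : ∀ y φ, 0 ≤ A y φ := fun _ _ => sq_nonneg _
  have hexp : ∀ (y : Bits k) (s : ℂ) (φ : ℝ), ‖Complex.exp s‖ = 1 →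
      ‖∑ z, fourierMatrix (bitsEquiv k) y z * (window (2 ^ k) (bitsEquiv k z) : ℂ) *
        (Complex.exp s * Complex.exp (2 * φ * Complex.I) ^ (bitsEquiv k z : ℕ))‖ ^ 2 = A y φ := by
    intro y s φ hs
    rw [hA]
    dsimp only
    rw [← one_mul ‖∑ z, fourierMatrix (bitsEquiv k) y z * (_ * _)‖, ← hs, ← norm_mul,
      Finset.mul_sum]
    congr 2
    exact Finset.sum_congr rfl fun z _ => by ring
  have hprob : ∀ y : Bits k, ∑ w, P (w, y) ≤ (A y (-θ) + A y θ) / 2 := by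
    intro y
    have h := sum_norm_sq_combination_le U x
      (fun z => fourierMatrix (bitsEquiv k) y z * (window (2 ^ k) (bitsEquiv k z) : ℂ))
      fun z => (1 - 2 * (bitsEquiv k z : ℕ)) * θ
    have h1 : ∀ z : Bits k,
        Complex.exp (((1 - 2 * ((bitsEquiv k z : ℕ) : ℝ)) * θ : ℝ) * Complex.I) =
        Complex.exp (θ * Complex.I) *
          Complex.exp (2 * ((-θ : ℝ) : ℂ) * Complex.I) ^ (bitsEquiv k z : ℕ) := by
      intro z
      rw [← Complex.exp_nat_mul, ← Complex.exp_add]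
      congr 1
      push_cast
      ring
    have h2 : ∀ z : Bits k,
        Complex.exp (-(((1 - 2 * ((bitsEquiv k z : ℕ) : ℝ)) * θ : ℝ) * Complex.I)) =
        Complex.exp ((-θ : ℝ) * Complex.I) *
          Complex.exp (2 * (θ : ℂ) * Complex.I) ^ (bitsEquiv k z : ℕ) := by
      intro z
      rw [← Complex.exp_nat_mul, ← Complex.exp_add]
      congr 1
      push_cast
      ring
    simp only [h1, h2] at h
    rw [hexp y _ _ (Complex.norm_exp_ofReal_mul_I _), hexp y _ _ (Complex.norm_exp_ofReal_mul_I _)]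
      at h
    refine le_trans (le_of_eq (Finset.sum_congr rfl fun w _ => ?_)) h
    change ‖(phaseCircuit a x k W F).finalState U (w, y)‖ ^ 2 = _
    rw [phaseCircuit_finalState U x k W F _ hW]
    congr 2
    exact Finset.sum_congr rfl fun z _ => (mul_assoc _ _ _).symm
  have hmom : ∀ φ, ∑ y, 4 * Real.sin (β y + φ) ^ 2 * A y φ ≤ 32 / ((2 ^ k : ℕ) : ℝ) ^ 2 :=
    fun φ => second_moment_le hL hML (bitsEquiv k) φ
  -- Chebyshev: for a bad `y`, both `β y - θ` and `β y + θ` have a sine of size at least `12 / 2 ^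
  -- k`, so both weights `4 * sin ^ 2 / (8 * (12 / 2 ^ k) ^ 2)` are at least `1 / 2`.
  have hbad : ∀ y : Bits k, ¬ |(|Real.sin (β y)| - √(outputProb U x))| ≤ 12 / 2 ^ k →
      (A y (-θ) + A y θ) / 2 ≤ (4 * Real.sin (β y + -θ) ^ 2 * A y (-θ) +
        4 * Real.sin (β y + θ) ^ 2 * A y θ) / (8 * (12 / 2 ^ k) ^ 2) := by
    intro y hy
    rw [not_le, ← sin_groverAngle, ← hθ] at hy
    have hsθ : |Real.sin θ| = Real.sin θ := by
      rw [hθ, sin_groverAngle]; exact abs_of_nonneg (Real.sqrt_nonneg _)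
    have h1 := abs_abs_sin_sub_abs_sin_le (β y) θ
    have h2 := abs_abs_sin_sub_abs_sin_le (β y) (-θ)
    rw [Real.sin_neg, abs_neg, hsθ, sub_neg_eq_add] at h2
    rw [hsθ, sub_eq_add_neg (β y)] at h1
    have hη : (0 : ℝ) < 12 / 2 ^ k := by positivity
    have h1' : (12 / 2 ^ k : ℝ) ^ 2 ≤ Real.sin (β y + -θ) ^ 2 := by
      rw [← sq_abs (Real.sin _)]
      exact pow_le_pow_left₀ hη.le (hy.le.trans h1) 2
    have h2' : (12 / 2 ^ k : ℝ) ^ 2 ≤ Real.sin (β y + θ) ^ 2 := by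
      rw [← sq_abs (Real.sin _)]
      exact pow_le_pow_left₀ hη.le (hy.le.trans h2) 2
    rw [le_div_iff₀ (by positivity)]
    have h3 := mul_le_mul_of_nonneg_right h1' (hAnn y (-θ))
    have h4 := mul_le_mul_of_nonneg_right h2' (hAnn y θ)
    linarith
  calc ∑ o : Work n a k with ¬ |(|Real.sin (β o.2)| - √(outputProb U x))| ≤ 12 / 2 ^ k, P o
      = ∑ y with ¬ |(|Real.sin (β y)| - √(outputProb U x))| ≤ 12 / 2 ^ k,
          ∑ w, P (w, y) := by
        rw [Finset.sum_filter, Finset.sum_filter]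
        rw [Fintype.sum_prod_type_right]
        refine Finset.sum_congr rfl fun y _ => ?_
        dsimp only
        split_ifs <;> simp
    _ ≤ ∑ y with ¬ |(|Real.sin (β y)| - √(outputProb U x))| ≤ 12 / 2 ^ k,
          (4 * Real.sin (β y + -θ) ^ 2 * A y (-θ) +
            4 * Real.sin (β y + θ) ^ 2 * A y θ) / (8 * (12 / 2 ^ k) ^ 2) := by
        refine Finset.sum_le_sum fun y hy => (hprob y).trans (hbad y ?_)
        exact (Finset.mem_filter.1 hy).2
    _ ≤ ∑ y, (4 * Real.sin (β y + -θ) ^ 2 * A y (-θ) +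
            4 * Real.sin (β y + θ) ^ 2 * A y θ) / (8 * (12 / 2 ^ k) ^ 2) := by
        refine Finset.sum_le_sum_of_subset_of_nonneg (Finset.filter_subset _ _) fun y _ _ => ?_
        have := hAnn y (-θ)
        have := hAnn y θ
        positivity
    _ ≤ (32 / ((2 ^ k : ℕ) : ℝ) ^ 2 + 32 / ((2 ^ k : ℕ) : ℝ) ^ 2) / (8 * (12 / 2 ^ k) ^ 2) := by
        rw [← Finset.sum_div, Finset.sum_add_distrib]
        gcongr
        · exact hmom (-θ)
        · exact hmom θ
    _ = 1 / 18 := by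
        push_cast
        field_simp
        norm_num

end PhaseEstimation

end PMax

namespace PMax

variable {n : ℕ}

/-! ### Estimating several probabilities -/

/-- The tail bound for fewer than `T + 1` successes among `2 * T + 1` trials of success probability
`17 / 18`. The base `2 * (19 / 36) ^ 2 = 361 / 648` lies below `exp (-1 / 2)`. -/
theorem two_pow_mul_pow_le_exp (T : ℕ) :
    2 ^ (T + 1) * (1 - 17 / 18 / 2 : ℝ) ^ (2 * T + 1) ≤ 2 * Real.exp (-(T / 2)) := by
  have h1 : (361 / 648 : ℝ) ≤ Real.exp (-(1 / 2)) := by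
    rw [Real.exp_neg, le_inv_comm₀ (by norm_num) (Real.exp_pos _)]
    have h := Real.exp_one_lt_d9
    have h2 : Real.exp (1 / 2) ^ 2 = Real.exp 1 := by
      rw [← Real.exp_nat_mul]; norm_num
    nlinarith [Real.exp_pos (1 / 2)]
  have h3 : Real.exp (-(T / 2 : ℝ)) = Real.exp (-(1 / 2)) ^ T := by
    rw [← Real.exp_nat_mul]; congr 1; ring
  calc 2 ^ (T + 1) * (1 - 17 / 18 / 2 : ℝ) ^ (2 * T + 1)
      = 19 / 18 * (2 * ((1 - 17 / 18 / 2) ^ 2)) ^ T := by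
        rw [mul_pow, ← pow_mul, pow_succ, pow_succ]; ring
    _ ≤ 2 * (361 / 648) ^ T := by
        norm_num
    _ ≤ 2 * Real.exp (-(T / 2)) := by rw [h3]; gcongr

open scoped Classical in
/-- Amplitude estimation with an error probability that is exponentially small in the number of
repetitions. -/
theorem exists_amplitudeEstimate (a : ℕ) (x : Bits n) {k : ℕ} (hk : 2 ≤ k) (T : ℕ) :
    ∃ p : Prog n a ℝ, p.Bounded (n + a + k) ((2 * T + 1) * (2 * 2 ^ k + 3)) ∧
      ∀ U, p.failure U (fun v _ => |v - √(outputProb U x)| ≤ 24 / 2 ^ k) ≤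
        2 * Real.exp (-(T / 2)) := by
  obtain ⟨p, hp, hpU⟩ := exists_amplitudeTrial a x hk
  set close : (Fin (2 * T + 1) → ℝ) → ℝ → Prop := fun w s =>
    T + 1 ≤ ∑ i, if |w i - s| ≤ 12 / 2 ^ k then 1 else 0 with hclose
  -- Any point close to a strict majority of the values will do: two majorities share an index,
  -- which doubles the error. The value `0` without such a point only matters in the failure event.
  set pick : (Fin (2 * T + 1) → ℝ) → ℝ := fun w =>
    if h : ∃ s, close w s then h.choose else 0 with hpick
  have hpick' : ∀ w s, close w s → |pick w - s| ≤ 24 / 2 ^ k := by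
    intro w s hs
    have hex : ∃ s, close w s := ⟨s, hs⟩
    have hc : close w (pick w) := by
      rw [hpick]
      simp only [hex, dif_pos]
      exact hex.choose_spec
    rw [hclose] at hc hs
    simp only [Finset.sum_boole, Nat.cast_id] at hc hs
    obtain ⟨i, hi⟩ := Finset.inter_nonempty_of_card_lt_card_add_card
      (Finset.filter_subset (fun i => |w i - s| ≤ 12 / 2 ^ k) Finset.univ)
      (Finset.filter_subset (fun i => |w i - pick w| ≤ 12 / 2 ^ k) Finset.univ)
      (by rw [Finset.card_univ, Fintype.card_fin]; omega)
    simp only [Finset.mem_inter, Finset.mem_filter, Finset.mem_univ, true_and] at hi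
    calc |pick w - s| ≤ |pick w - w i| + |w i - s| := abs_sub_le _ _ _
      _ ≤ 12 / 2 ^ k + 12 / 2 ^ k := add_le_add (by rw [abs_sub_comm]; exact hi.2) hi.1
      _ = 24 / 2 ^ k := by ring
  refine ⟨(p.replicate (2 * T + 1)).bind fun w => .pure (pick w),
    (hp.replicate _).bind_pure _, fun U => ?_⟩
  rw [← add_zero (2 * Real.exp _)]
  refine Prog.failure_bind_le U _ _ (P := fun w _ => close w √(outputProb U x)) ?_ le_rfl
    fun w q hw => (Prog.failure_pure U (hpick' w _ hw)).le
  refine le_trans ?_ (two_pow_mul_pow_le_exp T)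
  exact Prog.failure_replicate_le U (by norm_num) ((hpU U).trans (by norm_num)) _ _

/-- Estimating the largest of the probabilities of given outcomes. -/
theorem exists_maxEstimate (a : ℕ) {k : ℕ} (hk : 2 ≤ k) (T : ℕ) (l : List (Bits n)) :
    ∃ p : Prog n a ℝ, p.Bounded (n + a + k) (l.length * ((2 * T + 1) * (2 * 2 ^ k + 3))) ∧
      ∀ U, p.failure U (fun r _ => (∀ x ∈ l, √(outputProb U x) ≤ r + 24 / 2 ^ k) ∧
          r ≤ √(pMax U) + 24 / 2 ^ k) ≤ l.length * (2 * Real.exp (-(T / 2))) := by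
  induction l with
  | nil =>
    refine ⟨.pure 0, trivial, fun U => ?_⟩
    rw [Prog.failure_pure U ⟨by simp, by positivity⟩]
    simp
  | cons x l ih =>
    obtain ⟨p, hp, hpU⟩ := exists_amplitudeEstimate a x hk T
    obtain ⟨p', hp', hpU'⟩ := ih
    refine ⟨p.bind fun v => p'.bind fun r => .pure (max v r), ?_, fun U => ?_⟩
    · refine (hp.bind fun v => hp'.bind_pure _).mono le_rfl (le_of_eq ?_)
      rw [List.length_cons]
      ring
    · have h : ((x :: l).length : ℝ) * (2 * Real.exp (-(T / 2))) =
          2 * Real.exp (-(T / 2)) + (l.length * (2 * Real.exp (-(T / 2))) + 0) := by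
        rw [List.length_cons]; push_cast; ring
      rw [h]
      refine Prog.failure_bind_le U _ _ (hpU U) (by positivity) fun v q hv => ?_
      refine Prog.failure_bind_le U _ _ (hpU' U) le_rfl fun r q hr => (Prog.failure_pure U ?_).le
      rw [abs_le] at hv
      have hx := Real.sqrt_le_sqrt (outputProb_le_pMax U x)
      refine ⟨fun y hy => ?_, max_le (by linarith) hr.2⟩
      rcases List.mem_cons.1 hy with rfl | hy
      · linarith [le_max_left v r]
      · linarith [hr.1 y hy, le_max_right v r]

/-- The circuit that prepares and measures `O_D |0⟩`. -/
noncomputable def sampleCircuit (n a : ℕ) : Circuit n a where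
  extra := 0
  init := 1
  steps := [(false, 1)]

theorem exists_sample (n a : ℕ) : ∃ p : Prog n a (Bits n), p.Bounded (n + a) 1 ∧
    ∀ U x, p.failure U (fun v _ => v = x) = 1 - outputProb U x := by
  refine ⟨.run (sampleCircuit n a) fun o => .pure o.1.1, ⟨le_rfl, le_rfl, fun z => trivial⟩,
    fun U x => ?_⟩
  rw [Prog.failure_run_pure]
  set P : Work n a 0 → ℝ := fun o => (sampleCircuit n a).outcomeProb U o with hP
  have hPw : ∀ w z, P (w, z) = ‖oracleState U w‖ ^ 2 := by
    intro w z
    change ‖(1 : Matrix.unitaryGroup (Work n a 0) ℂ).1.mulVec ((queryOp U 0 false).mulVec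
      ((1 : Matrix.unitaryGroup (Work n a 0) ℂ).1.mulVec
        (Pi.single ((zeros n, zeros a), zeros 0) 1 : Work n a 0 → ℂ))) (w, z)‖ ^ 2 = _
    rw [OneMemClass.coe_one, Matrix.one_mulVec, Matrix.one_mulVec, queryOp_mulVec]
    have : (fun w' : Bits n × Bits a =>
        (Pi.single ((zeros n, zeros a), zeros 0) 1 : Work n a 0 → ℂ) (w', z)) =
        Pi.single (zeros n, zeros a) 1 := by
      ext w'
      simp [Pi.single_apply, Subsingleton.elim z (zeros 0)]
    rw [this]
    simp only [Bool.false_eq_true, if_false, Matrix.mulVec_single_one]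
    rfl
  rw [← sum_bad U x, Finset.sum_filter, Finset.sum_filter]
  trans ∑ o : Work n a 0, if ¬ o.1.1 = x then P o else 0
  · exact Finset.sum_congr rfl fun o _ => by congr
  rw [Fintype.sum_prod_type]
  refine Finset.sum_congr rfl fun w _ => ?_
  simp [hPw]

/-- Sampling gives a short list that contains every given outcome of large probability. -/
theorem exists_candidates (n a : ℕ) (B : ℕ) {T : ℕ} (hT : 0 < T) :
    ∃ p : Prog n a {S : Finset (Bits n) // S.card ≤ B}, p.Bounded (n + a) (B * T) ∧
      ∀ U x, 4 ≤ B * outputProb U x →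
        p.failure U (fun S _ => x ∈ S.1) ≤ Real.exp (-(T / 2)) := by
  obtain ⟨p, hp, hpU⟩ := exists_sample n a
  -- Each outcome kept accounts for at least `T` of the `B * T` samples.
  have hcard : ∀ w : Fin (B * T) → Bits n,
      (Finset.univ.filter fun x => T ≤ (Finset.univ.filter fun i => w i = x).card).card ≤ B := by
    intro w
    set S := Finset.univ.filter fun x => T ≤ (Finset.univ.filter fun i => w i = x).card
    have h1 : S.card * T ≤ ∑ x ∈ S, (Finset.univ.filter fun i => w i = x).card := by
      rw [← smul_eq_mul]
      exact Finset.card_nsmul_le_sum _ _ _ fun x hx => (Finset.mem_filter.1 hx).2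
    have h2 : ∑ x ∈ S, (Finset.univ.filter fun i => w i = x).card ≤
        ∑ x, (Finset.univ.filter fun i => w i = x).card :=
      Finset.sum_le_sum_of_subset (Finset.subset_univ S)
    have h3 := Finset.card_eq_sum_card_fiberwise (f := w) (s := Finset.univ) (t := Finset.univ)
      fun _ _ => Finset.mem_coe.2 (Finset.mem_univ _)
    rw [Finset.card_univ, Fintype.card_fin] at h3
    exact Nat.le_of_mul_le_mul_right (h1.trans (h2.trans h3.symm.le)) hT
  refine ⟨(p.replicate (B * T)).bind fun w => .pure ⟨_, hcard w⟩, ?_, fun U x hx => ?_⟩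
  · exact ((hp.replicate _).bind_pure _).mono le_rfl (by simp)
  · rw [← add_zero (Real.exp _)]
    refine Prog.failure_bind_le U _ _
      (P := fun w _ => T ≤ ∑ i, if w i = x then 1 else 0) ?_ le_rfl
      fun w q hw => (Prog.failure_pure U ?_).le
    · classical
      have h := Prog.failure_replicate_le U (p := p) (G := fun v => v = x)
        (outputProb_le_one U x) (hpU U x).le (B * T) T
      refine le_trans (le_of_eq ?_) (h.trans ?_)
      · congr! 6
      have h0 : 0 ≤ 1 - outputProb U x / 2 := by linarith [outputProb_le_one U x]
      have h1 : 1 - outputProb U x / 2 ≤ Real.exp (-(outputProb U x / 2)) := by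
        linarith [Real.add_one_le_exp (-(outputProb U x / 2))]
      have h2 : (2 : ℝ) ≤ Real.exp 1 := by linarith [Real.add_one_le_exp 1]
      -- With `2 ≤ e` and `B * p_x ≥ 4` the exponent is at most `-T`.
      calc 2 ^ T * (1 - outputProb U x / 2) ^ (B * T)
          ≤ Real.exp 1 ^ T * Real.exp (-(outputProb U x / 2)) ^ (B * T) := by gcongr
        _ = Real.exp (T * (1 - B * outputProb U x / 2)) := by
            rw [← Real.exp_nat_mul, ← Real.exp_nat_mul, ← Real.exp_add]
            congr 1
            push_cast
            ring
        _ ≤ Real.exp (-(T / 2)) := by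
            rw [Real.exp_le_exp]
            nlinarith [(Nat.cast_nonneg T : (0 : ℝ) ≤ T)]
    · simpa using hw

/-- Estimating `√p_max`, if it is not too small, with the help of sampling. -/
theorem exists_sampledMaxEstimate (n a : ℕ) {k : ℕ} (hk : 2 ≤ k) {B T : ℕ} (hB : 0 < B)
    (hT : 0 < T) :
    ∃ p : Prog n a ℝ, p.Bounded (n + a + k) (B * T + B * ((2 * T + 1) * (2 * 2 ^ k + 3))) ∧
      ∀ U, p.failure U (fun r _ => (4 ≤ B * pMax U → √(pMax U) ≤ r + 24 / 2 ^ k) ∧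
          r ≤ √(pMax U) + 24 / 2 ^ k) ≤ 3 * B * Real.exp (-(T / 2)) := by
  obtain ⟨p, hp, hpU⟩ := exists_candidates n a B hT
  choose e he heU using exists_maxEstimate (n := n) a hk T
  refine ⟨p.bind fun S => e S.1.toList, ?_, fun U => ?_⟩
  · refine (hp.mono (Nat.le_add_right _ _) le_rfl).bind fun S => (he _).mono le_rfl ?_
    rw [Finset.length_toList]
    exact Nat.mul_le_mul_right _ S.2
  · obtain ⟨x, hx⟩ := exists_outputProb_eq_pMax U
    have hB' : (1 : ℝ) ≤ B := Nat.one_le_cast.2 hB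
    have hexp := Real.exp_pos (-(T / 2 : ℝ))
    -- Only one most likely outcome `x` has to survive the sampling. The upper bound on `r` needs no
    -- such condition, since every probability that is estimated is at most `p_max`.
    refine (Prog.failure_bind_le U p _ (P := fun S _ => 4 ≤ B * pMax U → x ∈ S.1)
      (b := Real.exp (-(T / 2))) (b' := B * (2 * Real.exp (-(T / 2)))) ?_ (by positivity)
      fun S q hS => ?_).trans (by nlinarith)
    · by_cases h : 4 ≤ B * pMax U
      · refine le_trans (Prog.failure_mono U p fun S q hS _ => hS) (hpU U x (by rwa [hx]))
      · rw [Prog.failure_eq_zero U p fun S q h' => absurd h' h]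
        exact hexp.le
    · refine (Prog.failure_mono U _ ?_).trans ((heU S.1.toList U).trans ?_)
      · intro r q hr
        exact ⟨fun h => by rw [← hx]; exact hr.1 x (Finset.mem_toList.2 (hS h)), hr.2⟩
      · rw [Finset.length_toList]
        gcongr
        exact S.2

end PMax

namespace PMax

/-! ### Choice of the parameters -/

theorem exists_two_pow_near {X : ℝ} (hX : 4 ≤ X) :
    ∃ k : ℕ, 2 ≤ k ∧ X ≤ 2 ^ k ∧ (2 : ℝ) ^ k ≤ 2 * X := by
  obtain ⟨j, hj, hj'⟩ := exists_nat_pow_near (by linarith : 1 ≤ X) (one_lt_two (α := ℝ))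
  refine ⟨j + 1, ?_, hj'.le, by rw [pow_succ]; linarith⟩
  by_contra! h
  have h1 : (2 : ℝ) ^ (j + 1) ≤ 2 ^ 1 := pow_le_pow_right₀ one_le_two (by omega)
  linarith

theorem log_two_le_log_inv {y : ℝ} (hy : 0 < y) (hy' : y ≤ 1 / 2) :
    Real.log 2 ≤ Real.log (1 / y) := by
  refine Real.log_le_log two_pos ?_
  rw [le_div_iff₀ hy]
  linarith

theorem log_inv_le_log_inv_mul {δ p : ℝ} (hδ : 0 < δ) (hp : 0 < p) (hp' : p ≤ 1) :
    Real.log (1 / δ) ≤ Real.log (1 / (δ * p)) := by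
  refine Real.log_le_log (by positivity) ?_
  gcongr
  exact mul_le_of_le_one_right hδ.le hp'

/-- A number of repetitions for which an error probability `X * exp (-T / 2)` is at most one. -/
theorem exists_repetitions {X : ℝ} (hX : 2 ≤ X) :
    ∃ T : ℕ, 0 < T ∧ X * Real.exp (-(T / 2)) ≤ 1 ∧ (T : ℝ) ≤ 2 * Real.log X + 1 := by
  have hlog : 0 < Real.log X := Real.log_pos (by linarith)
  refine ⟨⌈2 * Real.log X⌉₊, Nat.ceil_pos.2 (by positivity), ?_,
    (Nat.ceil_lt_add_one (by positivity)).le⟩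
  have h := Nat.le_ceil (2 * Real.log X)
  rw [Real.exp_neg, ← div_eq_mul_inv, div_le_one (Real.exp_pos _)]
  calc X = Real.exp (Real.log X) := (Real.exp_log (by linarith)).symm
    _ ≤ _ := Real.exp_le_exp.2 (by linarith)

theorem natCast_mul_log_two_le {k : ℕ} {X : ℝ} (h : (2 : ℝ) ^ k ≤ X) :
    k * Real.log 2 ≤ Real.log X := by
  rw [← Real.log_pow]
  exact Real.log_le_log (by positivity) h

/-- Converts a bound on qubits, measured in natural logarithms, into the required form. The factor
`L` is not needed for the qubits; it is bounded below by `log 2 ≥ 1 / 2`. -/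
theorem le_mul_of_mul_log_two_le {Y Z L : ℝ} (h : Y * Real.log 2 ≤ 12 * Z) (hY : 0 ≤ Y)
    (hL : Real.log 2 ≤ L) : Y ≤ 48 * (Z * L) := by
  have hlog : 1 / 2 ≤ Real.log 2 := by linarith [Real.log_two_gt_d9]
  have h1 : Y * (1 / 2) ≤ Y * Real.log 2 := mul_le_mul_of_nonneg_left hlog hY
  have h2 : Z * (1 / 2) ≤ Z * L := mul_le_mul_of_nonneg_left (hlog.trans hL) (by linarith)
  linarith

/-! ### Relative accuracy -/

theorem pMax_eq_one {a : ℕ} (U : Oracle 0 a) : pMax U = 1 := by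
  have h := one_le_two_pow_mul_pMax U
  rw [pow_zero, one_mul] at h
  exact le_antisymm (pMax_le_one U) h

theorem exists_relativeEstimate {n : ℕ} (a : ℕ) {ε δ : ℝ} (hε : 0 < ε) (hε' : ε < 1)
    (hδ : 0 < δ) (hδ' : δ ≤ 1 / 2) :
    ∃ (p : Prog n a ℝ) (k q : ℕ), p.Bounded (n + a + k) q ∧
      (2 : ℝ) ^ k ≤ 768 * √(2 ^ n) / ε ∧
      (q : ℝ) ≤ 2 ^ n * (15 * (768 * √(2 ^ n) / ε) * (2 * Real.log (2 * 2 ^ n / δ) + 1)) ∧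
      ∀ U, p.failure U (fun v _ => (1 - ε) * v ≤ pMax U ∧ pMax U ≤ v) ≤ δ := by
  have hm : (1 : ℝ) ≤ √(2 ^ n) := Real.one_le_sqrt.2 (one_le_pow₀ one_le_two)
  obtain ⟨k, hk, hk1, hk2⟩ := exists_two_pow_near (X := 384 * √(2 ^ n) / ε) (by
    rw [le_div_iff₀ hε]; nlinarith)
  have hX : 2 ≤ 2 * 2 ^ n / δ := by
    rw [le_div_iff₀ hδ]
    nlinarith [one_le_pow₀ (one_le_two (α := ℝ)) (n := n)]
  obtain ⟨T, hT, hT1, hT2⟩ := exists_repetitions hX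
  have hk3 : (2 : ℝ) ^ k ≤ 768 * √(2 ^ n) / ε := hk2.trans (le_of_eq (by ring))
  obtain ⟨p, hp, hpU⟩ := exists_maxEstimate a hk T (Finset.univ : Finset (Bits n)).toList
  have hlen : (Finset.univ : Finset (Bits n)).toList.length = 2 ^ n := by simp
  rw [hlen] at hp hpU
  set e : ℝ := 24 / 2 ^ k with he
  -- Adding the error bound `e` before squaring makes the output an upper estimate.
  refine ⟨p.bind fun r => .pure ((r + e) ^ 2), k, _, hp.bind_pure _, hk3, ?_, fun U => ?_⟩
  · have hT' : (1 : ℝ) ≤ T := Nat.one_le_cast.2 hT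
    have h1 : (1 : ℝ) ≤ 2 ^ k := one_le_pow₀ one_le_two
    push_cast
    calc (2 : ℝ) ^ n * ((2 * T + 1) * (2 * 2 ^ k + 3)) ≤ 2 ^ n * ((3 * T) * (5 * 2 ^ k)) := by
          gcongr <;> linarith
      _ = 2 ^ n * (15 * 2 ^ k * T) := by ring
      _ ≤ _ := by gcongr
  · have hδe : ((2 ^ n : ℕ) : ℝ) * (2 * Real.exp (-(T / 2))) ≤ δ := by
      push_cast
      rw [div_mul_eq_mul_div, div_le_one hδ] at hT1
      linarith
    rw [← add_zero δ]
    refine Prog.failure_bind_le U _ _ ((hpU U).trans hδe) le_rfl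
      fun r q hr => (Prog.failure_pure U ?_).le
    obtain ⟨x, hx⟩ := exists_outputProb_eq_pMax U
    have h1 : √(pMax U) ≤ r + e := by rw [← hx]; exact hr.1 x (by simp)
    have h2 := hr.2
    set s := √(pMax U) with hs
    have hp0 := pMax_pos U
    have hs0 : 0 < s := Real.sqrt_pos.2 hp0
    have hss : s ^ 2 = pMax U := Real.sq_sqrt hp0.le
    have hms : 1 ≤ √(2 ^ n) * s := by
      rw [hs, ← Real.sqrt_mul (by positivity)]
      exact Real.one_le_sqrt.2 (one_le_two_pow_mul_pMax U)
    -- The choice of `k` together with `p_max ≥ 1 / m` makes the absolute error a relative one.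
    have he' : e ≤ s * (ε / 16) := by
      rw [he, div_le_iff₀ (by positivity)]
      calc (24 : ℝ) = 24 * 1 := by ring
        _ ≤ 24 * (√(2 ^ n) * s) := by gcongr
        _ = s * (ε / 16) * (384 * √(2 ^ n) / ε) := by field_simp; ring
        _ ≤ _ := by gcongr
    have h3 : r + e ≤ s * (1 + ε / 8) := by linarith
    have h4 : (r + e) ^ 2 ≤ (s * (1 + ε / 8)) ^ 2 := pow_le_pow_left₀ (by linarith) h3 2
    refine ⟨?_, ?_⟩
    · rw [← hss]
      have h5 : (1 - ε) * (1 + ε / 8) ^ 2 ≤ 1 := by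
        have h6 : (1 + ε / 8) ^ 2 ≤ 1 + ε := by nlinarith
        have h7 := mul_le_mul_of_nonneg_left h6 (sub_nonneg.2 hε'.le)
        nlinarith
      calc (1 - ε) * (r + e) ^ 2 ≤ (1 - ε) * (s * (1 + ε / 8)) ^ 2 := by
            gcongr
        _ = (1 - ε) * (1 + ε / 8) ^ 2 * s ^ 2 := by ring
        _ ≤ 1 * s ^ 2 := by gcongr
        _ = s ^ 2 := one_mul _
    · rw [← hss]
      exact pow_le_pow_left₀ hs0.le h1 2

/-! ### Additive accuracy -/

/-- One stage of the search for the order of magnitude of `p_max`. -/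
theorem exists_stage (n a : ℕ) {ε δ : ℝ} (hε : 0 < ε) (hδ : 0 < δ) (hδ' : δ ≤ 1 / 2) (i : ℕ)
    (hi : 4 ^ i * ε ≤ 4) :
    ∃ (p : Prog n a ℝ) (k q : ℕ), p.Bounded (n + a + k) q ∧ (2 : ℝ) ^ k ≤ 960 / ε ∧
      (q : ℝ) ≤ 23592960 / ε * Real.log (4 ^ i / δ) * 2 ^ i ∧
      ∀ U, p.failure U (fun r _ =>
        (1 ≤ 16 * 4 ^ i * pMax U → √(pMax U) ≤ r + ε * 2 ^ i / 20) ∧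
          r ≤ √(pMax U) + ε * 2 ^ i / 20) ≤ δ / 2 ^ (i + 1) := by
  set t : ℝ := 2 ^ i with ht
  have ht1 : 1 ≤ t := one_le_pow₀ one_le_two
  have h4 : (4 : ℝ) ^ i = t ^ 2 := by rw [ht, ← pow_mul, mul_comm, pow_mul]; norm_num
  have h8 : (8 : ℝ) ^ i = t ^ 3 := by rw [ht, ← pow_mul, mul_comm, pow_mul]; norm_num
  rw [h4] at hi
  -- This makes `24 / 2 ^ k` at most the target precision `ε * t / 20`.
  obtain ⟨k, hk, hk1, hk2⟩ := exists_two_pow_near (X := 480 / (ε * t)) (by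
    rw [le_div_iff₀ (by positivity)]; nlinarith)
  -- The failure bound `3 * B * exp (-T / 2)` with `B = 64 * 4 ^ i` must not exceed `δ / 2 ^ (i +
  -- 1)`, which asks for `384 * 8 ^ i / δ`, here rounded up.
  have hX : 2 ≤ 400 * 8 ^ i / δ := by
    rw [le_div_iff₀ hδ]
    nlinarith [one_le_pow₀ (by norm_num : (1 : ℝ) ≤ 8) (n := i)]
  obtain ⟨T, hT, hT1, hT2⟩ := exists_repetitions hX
  obtain ⟨p, hp, hpU⟩ := exists_sampledMaxEstimate n a hk (B := 64 * 4 ^ i) (by positivity) hT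
  have hT' : (1 : ℝ) ≤ T := Nat.one_le_cast.2 hT
  refine ⟨p, k, _, hp, ?_, ?_, fun U => ?_⟩
  · refine hk2.trans ?_
    rw [← mul_div_assoc]
    norm_num
    gcongr
    exact le_mul_of_one_le_right hε.le ht1
  · have hℓ : Real.log 2 ≤ Real.log (4 ^ i / δ) := by
      refine Real.log_le_log two_pos ?_
      rw [le_div_iff₀ hδ, h4]
      nlinarith
    have hℓ0 := Real.log_two_gt_d9
    have hT3 : (T : ℝ) ≤ 24 * Real.log (4 ^ i / δ) := by
      have hlog : Real.log (400 * 8 ^ i / δ) ≤ 11 * Real.log (4 ^ i / δ) := by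
        have : (11 : ℝ) = (11 : ℕ) := by norm_num
        rw [this, ← Real.log_pow]
        refine Real.log_le_log (by positivity) ?_
        set y : ℝ := 4 ^ i / δ with hy
        have hy2 : 2 ≤ y := by
          rw [hy, le_div_iff₀ hδ, h4]
          nlinarith
        have hy8 : 8 ^ i / δ ≤ y ^ 2 := by
          rw [hy, div_pow, div_le_div_iff₀ hδ (by positivity), h4, h8]
          have e1 : t ^ 3 * δ ^ 2 = (t ^ 3 * δ) * δ := by ring
          have e2 : (t ^ 2) ^ 2 * δ = (t ^ 3 * δ) * t := by ring
          rw [e1, e2]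
          gcongr
          linarith
        calc 400 * 8 ^ i / δ = 400 * (8 ^ i / δ) := by ring
          _ ≤ y ^ 9 * y ^ 2 := by
              gcongr
              calc (400 : ℝ) ≤ 2 ^ 9 := by norm_num
                _ ≤ y ^ 9 := by gcongr
          _ = y ^ 11 := by ring
      linarith
    have h1 : (1 : ℝ) ≤ 2 ^ k := one_le_pow₀ one_le_two
    push_cast
    rw [h4] at hT3 ⊢
    calc 64 * t ^ 2 * T + 64 * t ^ 2 * ((2 * T + 1) * (2 * 2 ^ k + 3))
        ≤ 64 * t ^ 2 * (T * 2 ^ k) + 64 * t ^ 2 * ((3 * T) * (5 * 2 ^ k)) := by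
          gcongr
          · exact le_mul_of_one_le_right (by positivity) h1
          · linarith
          · linarith
      _ = 1024 * t ^ 2 * (T * 2 ^ k) := by ring
      _ ≤ 1024 * t ^ 2 * (24 * Real.log (t ^ 2 / δ) * (2 * (480 / (ε * t)))) := by
          gcongr
          linarith
      _ = 23592960 / ε * Real.log (t ^ 2 / δ) * t := by
          field_simp
          ring
  · refine (Prog.failure_mono U p ?_).trans ((hpU U).trans ?_)
    · intro r q hr
      have he : 24 / 2 ^ k ≤ ε * t / 20 := by
        rw [div_le_iff₀ (by positivity)]
        calc (24 : ℝ) = ε * t / 20 * (480 / (ε * t)) := by field_simp; norm_num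
          _ ≤ _ := by gcongr
      refine ⟨fun h => ?_, by linarith [hr.2]⟩
      have := hr.1 (by push_cast; linarith)
      linarith
    · push_cast
      rw [div_mul_eq_mul_div, div_le_one hδ, h8] at hT1
      rw [le_div_iff₀ (by positivity), pow_succ, ← ht, h4]
      have := Real.exp_pos (-(T / 2 : ℝ))
      have h5 : 0 ≤ t ^ 3 * Real.exp (-(T / 2 : ℝ)) := by positivity
      nlinarith

/-- The search over the stages, starting with stage `i`. -/
theorem exists_search (n a : ℕ) {ε δ : ℝ} (hε : 0 < ε) (hδ : 0 < δ) (hδ' : δ ≤ 1 / 2) {K : ℕ}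
    (hK : 960 / ε < 2 ^ (K + 1)) (F i : ℕ) (hF : ∀ j < i + F, 4 ^ j * ε ≤ 4)
    (hF' : 4 < 4 ^ (i + F) * ε) :
    ∃ (p : Prog n a ℝ) (q : ℕ), p.Bounded (n + a + K) q ∧ ∀ U, 4 ^ i * pMax U ≤ 4 →
      p.failure U (fun v q => |pMax U - v| ≤ ε ∧
        (q : ℝ) ≤ 23592960 / ε * Real.log (4 / (δ * pMax U)) * (4 / √(pMax U) - 2 ^ i)) ≤
          δ / 2 ^ i := by
  -- The invariant `4 ^ i * p_max ≤ 4` says that stage `i` is not too late: its cost is at most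
  -- proportional to `1 / √p_max`.
  have facts : ∀ (U : Oracle n a) (i : ℕ), 4 ^ i * pMax U ≤ 4 →
      2 ^ i * √(pMax U) ≤ 2 ∧ (2 : ℝ) ^ i ≤ 2 / √(pMax U) ∧
        Real.log (4 ^ i / δ) ≤ Real.log (4 / (δ * pMax U)) ∧
        0 ≤ Real.log (4 / (δ * pMax U)) := by
    intro U i h
    have hp := pMax_pos U
    have hp1 := pMax_le_one U
    have hs : 0 < √(pMax U) := Real.sqrt_pos.2 hp
    have h1 : 2 ^ i * √(pMax U) ≤ 2 := by
      refine le_of_sq_le_sq ?_ two_pos.le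
      rw [mul_pow, Real.sq_sqrt hp.le, ← pow_mul, mul_comm i, pow_mul]
      norm_num
      exact h
    refine ⟨h1, (le_div_iff₀ hs).2 h1, Real.log_le_log (by positivity) ?_, Real.log_nonneg ?_⟩
    · rw [div_le_div_iff₀ hδ (by positivity)]
      nlinarith
    · rw [le_div_iff₀ (by positivity)]
      nlinarith
  induction F generalizing i with
  | zero =>
    -- All stages are exhausted, so `p_max ≤ 4 / 4 ^ i < ε`.
    refine ⟨.pure 0, 0, trivial, fun U hU => ?_⟩
    obtain ⟨h1, h2, -, h4⟩ := facts U i hU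
    have hp := pMax_pos U
    rw [Prog.failure_pure U]
    · positivity
    · refine ⟨?_, ?_⟩
      · rw [sub_zero, abs_of_pos hp]
        have h4i : (0 : ℝ) < 4 ^ i := by positivity
        have : 4 ^ i * pMax U ≤ 4 ^ i * ε := hU.trans hF'.le
        exact le_of_mul_le_mul_left this h4i
      · have h3 : 4 / √(pMax U) = 2 / √(pMax U) + 2 / √(pMax U) := by ring
        have : (0 : ℝ) < 2 ^ i := by positivity
        have : 0 ≤ 4 / √(pMax U) - 2 ^ i := by linarith
        rw [Nat.cast_zero]
        positivity
  | succ F ih =>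
    obtain ⟨p', q', hp', hpU'⟩ := ih (i + 1) (fun j hj => hF j (by omega))
      (by rwa [show i + 1 + F = i + (F + 1) by omega])
    have hi := hF i (by omega)
    obtain ⟨p, k, q, hp, hk, hq, hpU⟩ := exists_stage n a hε hδ hδ' i hi
    have hkK : k ≤ K := by
      by_contra! h
      exact absurd (hk.trans_lt hK) (not_lt.2 (pow_le_pow_right₀ one_le_two h))
    classical
    -- Accept if `r` is at least half of the guess `2 ^ (-i)`. As `2 ^ i` times the error is at most
    -- `1 / 5`, acceptance forces `2 ^ i * s ≥ 3 / 10`, where the lower estimate is valid, and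
    -- rejection forces `2 ^ i * s ≤ 1`, the invariant of the next stage.
    refine ⟨p.bind fun r => if 1 / 2 ≤ 2 ^ i * r then .pure (r ^ 2) else p', q + q', ?_,
      fun U hU => ?_⟩
    · refine (hp.mono (by omega) le_rfl).bind fun r => ?_
      split_ifs
      · trivial
      · exact hp'
    obtain ⟨h1, h2, h3, h4⟩ := facts U i hU
    have hsum : δ / 2 ^ i = δ / 2 ^ (i + 1) + δ / 2 ^ (i + 1) := by
      rw [pow_succ]; field_simp; norm_num
    rw [hsum]
    refine Prog.failure_bind_le U _ _ ((hp.failure_and_le U _).trans (hpU U)) (by positivity)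
      fun r q₁ hr => ?_
    obtain ⟨⟨hr1, hr2⟩, hq₁⟩ := hr
    have h4i : (4 : ℝ) ^ i = (2 ^ i) ^ 2 := by rw [← pow_mul, mul_comm, pow_mul]; norm_num
    set s := √(pMax U) with hs
    have hs0 : 0 < s := Real.sqrt_pos.2 (pMax_pos U)
    have hss : s ^ 2 = pMax U := Real.sq_sqrt (pMax_pos U).le
    have hcost : (q₁ : ℝ) ≤ 23592960 / ε * Real.log (4 / (δ * pMax U)) * 2 ^ i := by
      refine le_trans (Nat.cast_le.2 hq₁) (hq.trans ?_)
      gcongr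
    set D := 23592960 / ε * Real.log (4 / (δ * pMax U)) with hD
    have hD0 : 0 ≤ D := by positivity
    rw [h4i] at hr1 hi
    set t : ℝ := 2 ^ i with ht
    have ht0 : 0 < t := by positivity
    have hte : t * (ε * t / 20) ≤ 1 / 5 := by nlinarith
    have hbig : 1 ≤ 4 * (t * s) → s ≤ r + ε * t / 20 := by
      intro h
      refine hr1 ?_
      rw [← hss]
      nlinarith
    split_ifs with hlarge
    · rw [Prog.failure_pure U]
      · positivity
      refine ⟨?_, ?_⟩
      · have h5 := mul_le_mul_of_nonneg_left hr2 ht0.le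
        have h6 := hbig (by nlinarith)
        have hr0 : 0 < r := by
          by_contra! h
          nlinarith
        have h7 : |s - r| ≤ ε * t / 20 := abs_le.2 ⟨by linarith, by linarith⟩
        -- By the invariant `t * s ≤ 2`, and `t * r` exceeds `t * s` by at most `1 / 5`; so the
        -- precision `ε * t / 20` is ample.
        rw [← hss, show s ^ 2 - r ^ 2 = (s - r) * (s + r) by ring, abs_mul,
          abs_of_pos (by linarith : 0 < s + r)]
        calc |s - r| * (s + r) ≤ ε * t / 20 * (s + r) := by gcongr
          _ = ε / 20 * (t * s + t * r) := by ring
          _ ≤ ε / 20 * 20 := by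
              gcongr
              linarith
          _ = ε := by ring
      · rw [add_zero]
        refine hcost.trans ?_
        gcongr
        have : 4 / s = 2 / s + 2 / s := by ring
        linarith
    · have hnext : 4 ^ (i + 1) * pMax U ≤ 4 := by
        rw [pow_succ, h4i, ← hss]
        have : t * s ≤ 1 := by
          by_contra! h
          have h5 := mul_le_mul_of_nonneg_left (hbig (by linarith)) ht0.le
          linarith
        have h0 : 0 ≤ t * s := by positivity
        nlinarith
      refine (Prog.failure_mono U p' ?_).trans (hpU' U hnext)
      rintro v q₂ ⟨hv, hq₂⟩
      refine ⟨hv, ?_⟩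
      -- The budget telescopes: the cost `D * t` of this stage plus the remaining `D * (4 / s - 2 *
      -- t)` is `D * (4 / s - t)`.
      rw [pow_succ, ← ht] at hq₂
      push_cast
      nlinarith

end PMax

/-! ### The two accuracy bounds with absolute constants -/

theorem mainTheorem3 :
    -- additive accuracy
    (∃ C : ℝ, 0 < C ∧ ∀ (n a : ℕ) (ε δ : ℝ), 0 < ε → ε < 1 → 0 < δ → δ ≤ 1 / 2 →
      ∃ alg : PMax.Algorithm n a, ∀ U : PMax.Oracle n a,
        (alg.qubits : ℝ) ≤
          C * ((Real.log (2 ^ n) + Real.log (1 / ε) + a) * Real.log (1 / (δ * PMax.pMax U))) ∧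
        1 - δ ≤ alg.prob U (fun v q =>
          |PMax.pMax U - v| ≤ ε ∧
          (q : ℝ) ≤ C * (1 / (ε * √(PMax.pMax U)) * Real.log (1 / ε) *
            Real.log (1 / (δ * PMax.pMax U))))) ∧
    -- relative accuracy
    (∃ (C : ℝ) (c : ℕ), 0 < C ∧ ∀ (n a : ℕ) (ε δ : ℝ), 0 < ε → ε < 1 → 0 < δ → δ ≤ 1 / 2 →
      ∃ alg : PMax.Algorithm n a,
        (alg.maxQueries : ℝ) ≤
          C * ((2 ^ n : ℝ) ^ (3 / 2 : ℝ) / ε * (1 + Real.log (2 ^ n / ε)) ^ c *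
            Real.log (1 / δ)) ∧
        ∀ U : PMax.Oracle n a,
          (alg.qubits : ℝ) ≤
            C * ((Real.log (2 ^ n / ε) + a) * Real.log (1 / (δ * PMax.pMax U))) ∧
          1 - δ ≤ alg.prob U (fun v _ =>
            (1 - ε) * v ≤ PMax.pMax U ∧ PMax.pMax U ≤ v)) := by
  have hlog2 := Real.log_two_gt_d9
  have hlog2' := Real.log_two_lt_d9
  have log_two_pow : ∀ n : ℕ, Real.log (2 ^ n) = n * Real.log 2 := fun n => Real.log_pow 2 n
  have hlog1024 : Real.log 1024 = 10 * Real.log 2 := by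
    rw [show (1024 : ℝ) = 2 ^ 10 by norm_num, log_two_pow]; norm_num
  constructor
  · refine ⟨20 * 23592960, by norm_num, fun n a ε δ hε hε' hδ hδ' => ?_⟩
    have hLε : 0 ≤ Real.log (1 / ε) := Real.log_nonneg (by rw [le_div_iff₀ hε]; linarith)
    have hLδ : ∀ U : PMax.Oracle n a, Real.log 2 ≤ Real.log (1 / (δ * PMax.pMax U)) := by
      intro U
      have := PMax.pMax_pos U
      exact PMax.log_two_le_log_inv (by positivity) (by nlinarith [PMax.pMax_le_one U])
    -- As `ε` tends to `1`, the factor `log (1 / ε)` in the query bound tends to `0`; for `ε ≥ 1 /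
    -- 2` the constant `1 / 2` is accurate without queries.
    rcases le_or_gt (1 / 2) ε with hε2 | hε2
    · refine ⟨.output (1 / 2), fun U => ?_⟩
      have hL := hLδ U
      have hn0 := log_two_pow n
      have h0 : 0 ≤ Real.log (2 ^ n) := by rw [hn0]; positivity
      have h1 : 0 ≤ Real.log (1 / (δ * PMax.pMax U)) := by linarith
      have h2 := PMax.pMax_pos U
      have h3 := PMax.pMax_le_one U
      refine ⟨?_, ?_⟩
      · simp only [PMax.Algorithm.qubits, Nat.cast_zero]
        positivity
      · rw [PMax.Algorithm.prob, if_pos]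
        · linarith
        · refine ⟨abs_le.2 ⟨by linarith, by linarith⟩, ?_⟩
          rw [Nat.cast_zero]
          positivity
    -- Stages `0` to `F` are those with `4 ^ j * ε ≤ 4`; `K` bounds the counter registers of all of
    -- them.
    · obtain ⟨F, hF, hF'⟩ := exists_nat_pow_near (x := 4 / ε) (y := 4)
        (by rw [le_div_iff₀ hε]; linarith) (by norm_num)
      obtain ⟨K, hK, hK'⟩ := exists_nat_pow_near (x := 960 / ε) (y := 2)
        (by rw [le_div_iff₀ hε]; linarith) (by norm_num)
      obtain ⟨p, q, hp, hpU⟩ := PMax.exists_search n a hε hδ hδ' hK' (F + 1) 0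
        (fun j hj => by
          rw [← le_div_iff₀ hε]
          exact (pow_le_pow_right₀ (by norm_num) (by omega)).trans hF)
        (by rw [zero_add, ← div_lt_iff₀ hε]; exact hF')
      refine ⟨p.toAlgorithm, fun U => ?_⟩
      have hL := hLδ U
      have hp0 := PMax.pMax_pos U
      have hp1 := PMax.pMax_le_one U
      have hLε2 : Real.log 2 ≤ Real.log (1 / ε) := PMax.log_two_le_log_inv hε hε2.le
      set L := Real.log (1 / (δ * PMax.pMax U)) with hLdef
      refine ⟨?_, ?_⟩
      · have hq : (p.toAlgorithm.qubits : ℝ) ≤ n + a + K := by exact_mod_cast hp.qubits_le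
        have hKlog := PMax.natCast_mul_log_two_le hK
        have h960 : Real.log (960 / ε) ≤ 10 * Real.log 2 + Real.log (1 / ε) := by
          rw [← hlog1024, ← Real.log_mul (by norm_num) (by positivity)]
          refine Real.log_le_log (by positivity) ?_
          rw [mul_one_div]
          gcongr
          norm_num
        have hnlog := log_two_pow n
        have ha : (0 : ℝ) ≤ a := Nat.cast_nonneg a
        have hn : (0 : ℝ) ≤ n := Nat.cast_nonneg n
        have hX0 : 0 ≤ Real.log (2 ^ n) + Real.log (1 / ε) + a := by rw [hnlog]; positivity
        have h1 := mul_le_of_le_one_right ha (by linarith : Real.log 2 ≤ 1)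
        have h2 : ((n : ℝ) + a + K) * Real.log 2 =
          n * Real.log 2 + a * Real.log 2 + K * Real.log 2 := by ring
        have h3 : 0 ≤ (n : ℝ) * Real.log 2 := by positivity
        have h4 := PMax.le_mul_of_mul_log_two_le
          (Z := Real.log (2 ^ n) + Real.log (1 / ε) + a) (by linarith)
          (by positivity : (0 : ℝ) ≤ n + a + K) hL
        have h5 := mul_nonneg hX0 (by linarith : 0 ≤ L)
        linarith
      · rw [PMax.Prog.prob_toAlgorithm]
        have h := hpU U (by rw [pow_zero, one_mul]; linarith)
        rw [pow_zero, div_one] at h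
        refine sub_le_sub_left (le_trans (PMax.Prog.failure_mono U p ?_) h) 1
        rintro v r ⟨hv, hr⟩
        refine ⟨hv, hr.trans ?_⟩
        have hs : 0 < √(PMax.pMax U) := Real.sqrt_pos.2 hp0
        have h4 : Real.log (4 / (δ * PMax.pMax U)) ≤ 3 * L := by
          have e : 4 / (δ * PMax.pMax U) = 2 ^ 2 * (1 / (δ * PMax.pMax U)) := by ring
          rw [e, Real.log_mul (by norm_num) (by positivity), log_two_pow, ← hLdef]
          push_cast
          linarith
        have hL0 : 0 ≤ L := by linarith
        calc _ ≤ 23592960 / ε * (3 * L) * (4 / √(PMax.pMax U) - 0) := by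
              have h41 : 4 / √(PMax.pMax U) - 2 ^ 0 ≤ 4 / √(PMax.pMax U) - 0 :=
                sub_le_sub_left (by positivity) _
              have h42 : (0 : ℝ) ≤ 4 / √(PMax.pMax U) - 2 ^ 0 := by
                rw [pow_zero, sub_nonneg, le_div_iff₀ hs]
                linarith [Real.sqrt_le_one.2 hp1]
              gcongr
              exact zero_le_one
          _ = 23592960 * 12 * (1 / (ε * √(PMax.pMax U))) * 1 * L := by ring
          -- `ε < 1 / 2` gives `log (1 / ε) ≥ log 2 ≥ 12 / 20`, which absorbs the factor `1`.
          _ ≤ 23592960 * 12 * (1 / (ε * √(PMax.pMax U))) * (20 / 12 * Real.log (1 / ε)) * L := by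
              gcongr
              linarith
          _ = _ := by ring
  · refine ⟨15 * 768 * 6, 1, by norm_num, fun n a ε δ hε hε' hδ hδ' => ?_⟩
    have hLδ0 : Real.log 2 ≤ Real.log (1 / δ) := PMax.log_two_le_log_inv hδ hδ'
    have hLδ : ∀ U : PMax.Oracle n a, Real.log 2 ≤ Real.log (1 / (δ * PMax.pMax U)) := fun U =>
      hLδ0.trans (PMax.log_inv_le_log_inv_mul hδ (PMax.pMax_pos U) (PMax.pMax_le_one U))
    have hnlog := log_two_pow n
    have hnε : Real.log (2 ^ n) ≤ Real.log (2 ^ n / ε) := by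
      refine Real.log_le_log (by positivity) ?_
      rw [le_div_iff₀ hε]
      exact mul_le_of_le_one_right (by positivity) hε'.le
    have hnlog0 : 0 ≤ Real.log (2 ^ n) := by rw [hnlog]; positivity
    set Λ := Real.log (2 ^ n / ε) with hΛ
    have hΛ0 : 0 ≤ Λ := hnlog0.trans hnε
    have hLδ1 : 0 ≤ Real.log (1 / δ) := by linarith
    -- For `n = 0` the qubit bound can tend to `0` as `ε` tends to `1`, but then `p_max = 1` is
    -- known. For `n ≥ 1`, `Λ ≥ log 2` absorbs additive constants.
    rcases eq_or_ne n 0 with rfl | hn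
    · refine ⟨.output 1, ?_, fun U => ⟨?_, ?_⟩⟩
      · simp only [PMax.Algorithm.maxQueries, Nat.cast_zero]
        positivity
      · have := hLδ U
        have : 0 ≤ Real.log (1 / (δ * PMax.pMax U)) := by linarith
        simp only [PMax.Algorithm.qubits, Nat.cast_zero]
        positivity
      · rw [PMax.Algorithm.prob, PMax.pMax_eq_one, if_pos ⟨by linarith, le_rfl⟩]
        linarith
    · obtain ⟨p, k, q, hp, hk, hq, hpU⟩ := PMax.exists_relativeEstimate (n := n) a hε hε' hδ hδ'
      refine ⟨p.toAlgorithm, ?_, fun U => ⟨?_, ?_⟩⟩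
      · refine le_trans (Nat.cast_le.2 hp.maxQueries_le) (hq.trans ?_)
        have hpow : (2 ^ n : ℝ) ^ (3 / 2 : ℝ) = 2 ^ n * √(2 ^ n) := by
          rw [show (3 / 2 : ℝ) = 1 + 1 / 2 by norm_num, Real.rpow_add (by positivity),
            Real.rpow_one, Real.sqrt_eq_rpow]
        have hT : 2 * Real.log (2 * 2 ^ n / δ) + 1 ≤ 6 * ((1 + Λ) * Real.log (1 / δ)) := by
          have e : 2 * 2 ^ n / δ = 2 * 2 ^ n * (1 / δ) := by ring
          rw [e, Real.log_mul (by positivity) (by positivity),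
            Real.log_mul (by norm_num) (by positivity)]
          nlinarith
        rw [hpow, pow_one]
        calc _ ≤ 2 ^ n * (15 * (768 * √(2 ^ n) / ε) * (6 * ((1 + Λ) * Real.log (1 / δ)))) := by
              gcongr
          _ = _ := by ring
      · have hq : (p.toAlgorithm.qubits : ℝ) ≤ n + a + k := by exact_mod_cast hp.qubits_le
        have hklog := PMax.natCast_mul_log_two_le hk
        have h768 : Real.log (768 * √(2 ^ n) / ε) ≤ 10 * Real.log 2 + Λ := by
          rw [← hlog1024, hΛ, ← Real.log_mul (by norm_num) (by positivity)]
          refine Real.log_le_log (by positivity) ?_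
          rw [← mul_div_assoc]
          have : √((2 : ℝ) ^ n) ≤ 2 ^ n := by
            rw [Real.sqrt_le_left (by positivity)]
            exact le_self_pow₀ (one_le_pow₀ one_le_two) two_ne_zero
          gcongr
          norm_num
        have hL := hLδ U
        set L := Real.log (1 / (δ * PMax.pMax U)) with hLdef
        have ha : (0 : ℝ) ≤ a := Nat.cast_nonneg a
        have hn1 : (1 : ℝ) ≤ n := Nat.one_le_cast.2 (Nat.one_le_iff_ne_zero.2 hn)
        rw [hnlog] at hnε
        have h0 : Real.log 2 ≤ Λ := (le_mul_of_one_le_left (by linarith) hn1).trans hnε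
        have h1 := mul_le_of_le_one_right ha (by linarith : Real.log 2 ≤ 1)
        have h2 : ((n : ℝ) + a + k) * Real.log 2 =
          n * Real.log 2 + a * Real.log 2 + k * Real.log 2 := by ring
        have h3 := PMax.le_mul_of_mul_log_two_le (Z := Λ + a) (by linarith)
          (by positivity : (0 : ℝ) ≤ n + a + k) hL
        have h4 : 0 ≤ (Λ + a) * L := mul_nonneg (by linarith) (by linarith)
        linarith
      · rw [PMax.Prog.prob_toAlgorithm]
        exact sub_le_sub_left (hpU U) 1
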